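/- Let $0\le n_0\le n_N\le n_T$ be integers and $n_{\mathrm{red}}=n_N-n_0$. Let $C=\mathbb{R}^{n_N}\subseteq\mathbb{R}^{n_T}$ be the subspace on which the last $n_T-n_N$ coordinates vanish, with the distribution spanned by $\partial_1,\dots,\partial_{n_0}$, and let $\pi\colon C\to\mathbb{R}^{n_{\mathrm{red}}}$ forget the first $n_0$ coordinates. Let $A_T=C^\infty(\mathbb{R}^{n_T})$, $A_0=\{f : f|_C=0\}$ and $A_N=\{f : \partial_i f|_C=0 \text{ for } i\le n_0\}$. A constraint module is $E=(E_T,E_N,E_0)$ with $E_0\subseteq E_N$ and a linear map $\iota\colon E_N\to E_T$; its reduction is $E_{\mathrm{red}}=E_N/E_0$. A constraint morphism is a pair $(f_T,f_N)$ with $\iota f_N=f_T\iota$ and $f_N(E_0)\subseteq F_0$. Consider the following constraint $\mathbb{R}$-modules. * $C^2_{\mathrm{diff}}(A)$: the $T$-component consists of the bidifferential operators $B$ (of finite order) on $\mathbb{R}^{n_T}$, the $N$-component of those with $B(A_N,A_N)\subseteq A_N$ and $B(A_0,A_N)+B(A_N,A_0)\subseteq A_0$, the $0$-component of those which moreover satisfy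 $B(A_N,A_N)\subseteq A_0$. Similarly $C^1_{\mathrm{diff}}(A)_N$ consists of the differential operators preserving $A_N$ and $A_0$. * $HH^2_{\mathrm{diff}}(A)$: with the Hochschild differential $\delta$, the components are $HH^2_{\mathrm{diff}}(C^\infty(\mathbb{R}^{n_T}))$, the quotient $\ker(\delta|_{C^2_{\mathrm{diff}}(A)_N})/\delta(C^1_{\mathrm{diff}}(A)_N)$, and the classes in it of cocycles in $C^2_{\mathrm{diff}}(A)_0$. * $\mathfrak{X}^2_{\mathrm{ext}}$: let $\Gamma_T$ be the vector fields $Y=\sum_iY^i\partial_i$ on $\mathbb{R}^{n_T}$, $\Gamma_0=\{Y: Y^i\in A_0 \text{ for } i>n_0\}$ and $\Gamma_N=\{Y : Y^i\in A_0\text{ for }i>n_N,\ Y^i\in A_N\text{ for }n_0<i\le n_N\}$. Put $\mathfrak{X}^2_0=\Gamma_0\wedge\Gamma_T$ and $\mathfrak{X}^2_N=\Gamma_N\wedge\Gamma_N+\Gamma_0\wedge\Gamma_T$, and let $S$ be the space of finite sums $D=\sum_I D^I\,\partial_{i_1}\vee\dots\vee\partial_{i_k}\vee\partial_t$ with $k\ge1$,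 $i_1,\dots,i_k\le n_0$, $t>n_N$ and $D^I\in C^\infty(\mathbb{R}^{n_N})$. Then the components are $\mathfrak{X}^2(\mathbb{R}^{n_T})$, $\mathfrak{X}^2_N\oplus S$ and $\mathfrak{X}^2_0\oplus S$, with $\iota(X,D)=X$. Let $\mathcal{U}(X)(f,g)=\frac12X(\mathrm{d}f,\mathrm{d}g)$ be the classical HKR map, and let $\mathcal{U}_{\mathrm{ext}}$ be given by $X\mapsto\mathcal{U}(X)$ on $T$-components and by $(X,D)\mapsto\mathcal{U}(X)+\delta(\mathrm{Op}(\mathrm{prol}(D)))$ on $N$-components, where $\mathrm{Op}(\mathrm{prol}(D))$ is the differential operator $\sum_I D^I\,\partial_{i_1}\cdots\partial_{i_k}\partial_t$ with the coefficients extended constantly from $\mathbb{R}^{n_N}$ to $\mathbb{R}^{n_T}$. On cochains its $N$-component maps $(\mathfrak{X}^2_{\mathrm{ext}})_0$ into $C^2_{\mathrm{diff}}(A)_0$, so that it has a reduction (its two components are compatible with $\iota$ up to coboundaries); in cohomology it is a constraint morphism. **Proposition.** There are canonical linear isomorphisms $\Phi\colon(\mathfrak{X}^2_{\mathrm{ext}})_{\mathrm{red}}\to\mathfrak{X}^2(\mathbb{R}^{n_{\mathrm{red}}})$,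 $\Psi\colon C^2_{\mathrm{diff}}(A)_{\mathrm{red}}\to C^2_{\mathrm{diff}}(C^\infty(\mathbb{R}^{n_{\mathrm{red}}}))$ and $\Theta\colon HH^2_{\mathrm{diff}}(A)_{\mathrm{red}}\to HH^2_{\mathrm{diff}}(C^\infty(\mathbb{R}^{n_{\mathrm{red}}}))$, determined as follows: $\Phi[(X,D)]$ is the bivector field to which $X|_C$ is $\pi$-related; $\Psi[B]=b$, where $B(f,g)|_C=\pi^*b(a,a')$ whenever $f|_C=\pi^*a$ and $g|_C=\pi^*a'$; and $\Theta[[B]]=[b]$ with $b$ obtained from the cocycle $B$ in the same way. Moreover: 1. On cochains, $(\mathcal{U}_{\mathrm{ext}})_{\mathrm{red}}$ is the classical HKR map $\mathfrak{X}^2(\mathbb{R}^{n_{\mathrm{red}}})\to C^2_{\mathrm{diff}}(C^\infty(\mathbb{R}^{n_{\mathrm{red}}}))$, i.e. $\Psi\circ(\mathcal{U}_{\mathrm{ext}})_{\mathrm{red}}=\mathcal{U}\circ\Phi$. 2. In cohomology, $\mathcal{U}_{\mathrm{ext}}\colon\mathfrak{X}^2_{\mathrm{ext}}\to HH^2_{\mathrm{diff}}(A)$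 is an isomorphism of constraint $\mathbb{R}$-modules, its reduction is bijective, and it is the classical HKR isomorphism $\mathfrak{X}^2(\mathbb{R}^{n_{\mathrm{red}}})\to HH^2_{\mathrm{diff}}(C^\infty(\mathbb{R}^{n_{\mathrm{red}}}))$, i.e. $\Theta\circ(\mathcal{U}_{\mathrm{ext}})_{\mathrm{red}}=[\mathcal{U}(\cdot)]\circ\Phi$ with $[\mathcal{U}(\cdot)]$ bijective. -/

import Mathlib

open scoped ContDiff

noncomputable section

namespace ConstraintHKR

/-! ### Constraint modules and their reduction -/

/-- A constraint `ℝ`-module `(E_T, E_N, E_0)`: two modules, a linear map `ι : E_N → E_T`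
(not necessarily injective) and a submodule `E_0 ⊆ E_N`. -/
structure ConModule where
  T : Type
  N : Type
  [groupT : AddCommGroup T]
  [groupN : AddCommGroup N]
  [moduleT : Module ℝ T]
  [moduleN : Module ℝ N]
  O : Submodule ℝ N
  ι : N →ₗ[ℝ] T

attribute [instance] ConModule.groupT ConModule.groupN ConModule.moduleT ConModule.moduleN

/-- The reduction `E_red = E_N / E_0`. -/
abbrev ConModule.Red (E : ConModule) : Type := E.N ⧸ E.O

/-- A pair of linear maps between the `T`- and the `N`-components whose `N`-component maps
`E_0` to `F_0`; this is what is needed to pass to the reduction. -/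
structure ConPair (E F : ConModule) where
  T : E.T →ₗ[ℝ] F.T
  N : E.N →ₗ[ℝ] F.N
  map_O : ∀ x ∈ E.O, N x ∈ F.O

/-- The induced map `E_red → F_red`, `[x] ↦ [f_N x]`. -/
def ConPair.red {E F : ConModule} (f : ConPair E F) : E.Red →ₗ[ℝ] F.Red :=
  E.O.mapQ F.O f.N f.map_O

/-- A morphism of constraint modules: a pair as above which also intertwines the maps `ι`. -/
structure ConHom (E F : ConModule) extends ConPair E F where
  comm : ∀ x, F.ι (N x) = T (E.ι x)

/-- Isomorphisms of constraint modules: there is an inverse morphism of constraint modules. -/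
def ConHom.IsIso {E F : ConModule} (f : ConHom E F) : Prop :=
  ∃ g : ConHom F E, (∀ x, g.T (f.T x) = x) ∧ (∀ y, f.T (g.T y) = y) ∧
    (∀ x, g.N (f.N x) = x) ∧ (∀ y, f.N (g.N y) = y)

/-! ### Smooth functions on `ℝ^ι` and partial derivatives -/

section Classical

variable {ι : Type} [Fintype ι]

/-- The smooth functions on `ℝ^ι` as a subalgebra of all functions. -/
def smoothAlg (ι : Type) [Fintype ι] : Subalgebra ℝ ((ι → ℝ) → ℝ) where
  carrier := {f | ContDiff ℝ ∞ f}
  mul_mem' {_ _} (hf : ContDiff ℝ ∞ _) (hg : ContDiff ℝ ∞ _) := hf.mul hg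
  add_mem' {_ _} (hf : ContDiff ℝ ∞ _) (hg : ContDiff ℝ ∞ _) := hf.add hg
  algebraMap_mem' r := show ContDiff ℝ ∞ (fun _ : ι → ℝ => r) from contDiff_const

/-- The algebra `C^∞(ℝ^ι)`. -/
def Smooth (ι : Type) [Fintype ι] : Type := smoothAlg ι

instance : CommRing (Smooth ι) := inferInstanceAs (CommRing (smoothAlg ι))

instance : Algebra ℝ (Smooth ι) := inferInstanceAs (Algebra ℝ (smoothAlg ι))

instance : CoeFun (Smooth ι) (fun _ => (ι → ℝ) → ℝ) := ⟨Subtype.val⟩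

/-- A smooth function as an element of `C^∞(ℝ^ι)`. -/
def Smooth.mk (f : (ι → ℝ) → ℝ) (hf : ContDiff ℝ ∞ f) : Smooth ι := ⟨f, hf⟩

theorem Smooth.contDiff (f : Smooth ι) : ContDiff ℝ ∞ f := f.property

theorem Smooth.diff (f : Smooth ι) : Differentiable ℝ f := f.contDiff.differentiable (by simp)

theorem Smooth.ext {f g : Smooth ι} (h : ∀ x, f x = g x) : f = g := Subtype.ext (funext h)

theorem Smooth.mk_apply (f : (ι → ℝ) → ℝ) (hf : ContDiff ℝ ∞ f) (x : ι → ℝ) :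
    Smooth.mk f hf x = f x := rfl

theorem Smooth.add_apply (f g : Smooth ι) (x : ι → ℝ) : (f + g) x = f x + g x := rfl

theorem Smooth.mul_apply (f g : Smooth ι) (x : ι → ℝ) : (f * g) x = f x * g x := rfl

theorem Smooth.zero_apply (x : ι → ℝ) : (0 : Smooth ι) x = 0 := rfl

theorem Smooth.smul_apply (c : ℝ) (f : Smooth ι) (x : ι → ℝ) : (c • f) x = c * f x := rfl

/-- Pullback of smooth functions along `x ↦ x ∘ e`. -/
def Smooth.pull {κ : Type} [Fintype κ] (e : κ → ι) : Smooth κ →ₗ[ℝ] Smooth ι where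
  toFun f := Smooth.mk (fun x => f (fun k => x (e k)))
    (f.contDiff.comp (contDiff_pi.2 fun k => contDiff_apply ℝ ℝ (e k)))
  map_add' _ _ := rfl
  map_smul' _ _ := rfl

variable [DecidableEq ι]

/-- The partial derivative `∂/∂x^i` as a derivation of `C^∞(ℝ^ι)`. -/
def pd (i : ι) : Derivation ℝ (Smooth ι) (Smooth ι) :=
  Derivation.mk'
    { toFun := fun f => Smooth.mk (fun x => fderiv ℝ f x (Pi.single i 1))
        ((f.contDiff.fderiv_right (m := ∞) le_rfl).clm_apply contDiff_const)
      map_add' := fun f g => Smooth.ext fun x =>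
        congrArg (fun L : (ι → ℝ) →L[ℝ] ℝ => L (Pi.single i 1))
          (fderiv_add (f.diff x) (g.diff x))
      map_smul' := fun c f => Smooth.ext fun x =>
        congrArg (fun L : (ι → ℝ) →L[ℝ] ℝ => L (Pi.single i 1))
          (fderiv_const_smul (f.diff x) c) }
    (fun f g => Smooth.ext fun x =>
        congrArg (fun L : (ι → ℝ) →L[ℝ] ℝ => L (Pi.single i 1))
          (fderiv_mul (f.diff x) (g.diff x)))

theorem pd_apply (i : ι) (f : Smooth ι) (x : ι → ℝ) :
    pd i f x = fderiv ℝ f x (Pi.single i 1) := rfl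

theorem pd_comm (i j : ι) (f : Smooth ι) : pd i (pd j f) = pd j (pd i f) := by
  have hd : Differentiable ℝ (fderiv ℝ (f : (ι → ℝ) → ℝ)) :=
    (f.contDiff.fderiv_right (m := ∞) le_rfl).differentiable (by simp)
  have key : ∀ (a b : ι) (x : ι → ℝ), pd a (pd b f) x =
      fderiv ℝ (fderiv ℝ f) x (Pi.single a 1) (Pi.single b 1) := by
    intro a b x
    have h : (pd b f : (ι → ℝ) → ℝ) = fun y => (fderiv ℝ f y) (Pi.single b 1) := rfl
    rw [pd_apply, h, fderiv_clm_apply (hd x) (differentiableAt_const _)]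
    simp
  refine Smooth.ext fun x => ?_
  rw [key, key]
  refine (f.contDiff.contDiffAt (x := x)).isSymmSndFDerivAt ?_ _ _
  simp only [minSmoothness_of_isRCLikeNormedField]
  exact WithTop.coe_le_coe.2 le_top

instance : LeftCommutative
    (fun (i : ι) (D : Smooth ι →ₗ[ℝ] Smooth ι) => (pd i : Smooth ι →ₗ[ℝ] Smooth ι) ∘ₗ D) where
  left_comm i j D := by
    ext1 f
    exact pd_comm i j (D f)

/-- The iterated partial derivative `∂_I = ∂^r / ∂x^{i_1} ⋯ ∂x^{i_r}` for the unordered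
multi-index `I = {i_1, …, i_r}`. -/
def pds (I : Multiset ι) : Smooth ι →ₗ[ℝ] Smooth ι :=
  Multiset.foldr (fun i D => (pd i : Smooth ι →ₗ[ℝ] Smooth ι) ∘ₗ D) LinearMap.id I

theorem pds_zero (f : Smooth ι) : pds 0 f = f := rfl

theorem pds_cons (i : ι) (I : Multiset ι) (f : Smooth ι) :
    pds (i ::ₘ I) f = pd i (pds I f) := by
  simp [pds]

/-! ### Differential Hochschild cochains in degrees one and two -/

/-- The Hochschild `1`-cochains of `C^∞(ℝ^ι)`. -/
abbrev Hom1 (ι : Type) [Fintype ι] : Type := Smooth ι →ₗ[ℝ] Smooth ι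

/-- The Hochschild `2`-cochains of `C^∞(ℝ^ι)`. -/
abbrev Hom2 (ι : Type) [Fintype ι] : Type := Smooth ι →ₗ[ℝ] Smooth ι →ₗ[ℝ] Smooth ι

instance (ι : Type) [Fintype ι] : AddCommGroup (Hom1 ι) := LinearMap.addCommGroup

instance (ι : Type) [Fintype ι] : AddCommGroup (Hom2 ι) := LinearMap.addCommGroup

/-- The cup product `(D ∪ E)(f, g) = D(f) E(g)`. -/
def cup {ι : Type} [Fintype ι] (D E : Hom1 ι) : Hom2 ι :=
  (LinearMap.mul ℝ (Smooth ι)).compl₁₂ D E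

theorem cup_apply {ι : Type} [Fintype ι] (D E : Hom1 ι) (f g : Smooth ι) :
    cup D E f g = D f * E g := rfl

/-- Differential operators of finite order, `∑_I D^I ∂_I` with smooth coefficients. -/
def C1diff (ι : Type) [Fintype ι] [DecidableEq ι] : Submodule (Smooth ι) (Hom1 ι) :=
  Submodule.span (Smooth ι) (Set.range pds)

/-- Bidifferential operators of finite order, `∑_{I,J} B^{IJ} ∂_I ∪ ∂_J`
with smooth coefficients. -/
def C2diff (ι : Type) [Fintype ι] [DecidableEq ι] : Submodule (Smooth ι) (Hom2 ι) :=
  Submodule.span (Smooth ι) (Set.range fun p : Multiset ι × Multiset ι => cup (pds p.1) (pds p.2))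

/-- The Hochschild differential on `1`-cochains: `(δD)(f,g) = f D(g) - D(fg) + D(f) g`. -/
def δ₁ {ι : Type} [Fintype ι] : Hom1 ι →ₗ[ℝ] Hom2 ι where
  toFun D := cup LinearMap.id D - (LinearMap.mul ℝ (Smooth ι)).compr₂ D + cup D LinearMap.id
  map_add' D E := by
    ext1 f; ext1 g
    simp only [LinearMap.add_apply, LinearMap.sub_apply, cup_apply, LinearMap.compr₂_apply,
      LinearMap.mul_apply', LinearMap.id_apply]
    ring
  map_smul' c D := by
    ext1 f; ext1 g
    simp only [LinearMap.add_apply, LinearMap.sub_apply, cup_apply, LinearMap.compr₂_apply,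
      LinearMap.mul_apply', LinearMap.id_apply, LinearMap.smul_apply, RingHom.id_apply,
      smul_add, smul_sub, mul_smul_comm, smul_mul_assoc]

theorem δ₁_apply {ι : Type} [Fintype ι] (D : Hom1 ι) (f g : Smooth ι) :
    δ₁ D f g = f * D g - D (f * g) + D f * g := rfl

/-- The Hochschild differential on `2`-cochains:
`(δB)(f,g,h) = f B(g,h) - B(fg,h) + B(f,gh) - B(f,g) h`. -/
def δ₂ {ι : Type} [Fintype ι] : Hom2 ι →ₗ[ℝ] (Smooth ι → Smooth ι → Smooth ι → Smooth ι) where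
  toFun B f g h := f * B g h - B (f * g) h + B f (g * h) - B f g * h
  map_add' B B' := by
    funext f g h
    simp only [LinearMap.add_apply, Pi.add_apply]
    ring
  map_smul' c B := by
    funext f g h
    simp only [LinearMap.smul_apply, Pi.smul_apply, RingHom.id_apply,
      smul_add, smul_sub, mul_smul_comm, smul_mul_assoc]

theorem δ₂_apply {ι : Type} [Fintype ι] (B : Hom2 ι) (f g h : Smooth ι) :
    δ₂ B f g h = f * B g h - B (f * g) h + B f (g * h) - B f g * h := rfl

theorem δ₂_δ₁ {ι : Type} [Fintype ι] (D : Hom1 ι) : δ₂ (δ₁ D) = 0 := by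
  funext f g h
  simp only [δ₂_apply, δ₁_apply, Pi.zero_apply, mul_assoc]
  ring

/-- Differential Hochschild `2`-cocycles of `C^∞(ℝ^ι)`. -/
def Z2 (ι : Type) [Fintype ι] [DecidableEq ι] : Submodule ℝ (Hom2 ι) :=
  (C2diff ι).restrictScalars ℝ ⊓ LinearMap.ker δ₂

/-- Coboundaries of differential Hochschild `1`-cochains of `C^∞(ℝ^ι)`. -/
def B2 (ι : Type) [Fintype ι] [DecidableEq ι] : Submodule ℝ (Hom2 ι) :=
  ((C1diff ι).restrictScalars ℝ).map δ₁

/-- `HH²_diff(C^∞(ℝ^ι))`. -/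
abbrev HH2diff (ι : Type) [Fintype ι] [DecidableEq ι] : Type := Z2 ι ⧸ (B2 ι).submoduleOf (Z2 ι)

theorem C2diff_pd_comp (i : ι) {B : Hom2 ι} (hB : B ∈ C2diff ι) :
    B.compr₂ (pd i : Hom1 ι) ∈ C2diff ι := by
  induction hB using Submodule.span_induction with
  | mem B hB =>
    obtain ⟨⟨I, J⟩, rfl⟩ := hB
    have : (cup (pds I) (pds J)).compr₂ (pd i : Hom1 ι) =
        cup (pds I) (pds (i ::ₘ J)) + cup (pds (i ::ₘ I)) (pds J) := by
      ext1 f; ext1 g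
      simp only [LinearMap.compr₂_apply, cup_apply, LinearMap.add_apply, pds_cons,
        Derivation.coeFn_coe, Derivation.leibniz, smul_eq_mul]
      ring
    rw [this]
    exact add_mem (Submodule.subset_span ⟨(I, i ::ₘ J), rfl⟩)
      (Submodule.subset_span ⟨(i ::ₘ I, J), rfl⟩)
  | zero =>
    have : (0 : Hom2 ι).compr₂ (pd i : Hom1 ι) = 0 := by
      ext1 f; ext1 g; simp
    rw [this]; exact zero_mem _
  | add B B' _ _ h h' =>
    have : (B + B').compr₂ (pd i : Hom1 ι) =
        B.compr₂ (pd i : Hom1 ι) + B'.compr₂ (pd i : Hom1 ι) := by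
      ext1 f; ext1 g; simp
    rw [this]; exact add_mem h h'
  | smul c B hB h =>
    have : (c • B).compr₂ (pd i : Hom1 ι) = c • B.compr₂ (pd i : Hom1 ι) + (pd i c) • B := by
      ext1 f; ext1 g
      simp only [LinearMap.compr₂_apply, LinearMap.smul_apply, LinearMap.add_apply,
        Derivation.coeFn_coe, Derivation.leibniz, smul_eq_mul]
      ring
    rw [this]
    exact add_mem (Submodule.smul_mem _ _ h) (Submodule.smul_mem _ _ hB)

theorem mul_comp_mem {D : Hom1 ι} (hD : D ∈ C1diff ι) :
    (LinearMap.mul ℝ (Smooth ι)).compr₂ D ∈ C2diff ι := by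
  induction hD using Submodule.span_induction with
  | mem D hD =>
    obtain ⟨I, rfl⟩ := hD
    induction I using Multiset.induction_on with
    | empty => exact Submodule.subset_span ⟨(0, 0), rfl⟩
    | cons i I ih =>
      have : (LinearMap.mul ℝ (Smooth ι)).compr₂ (pds (i ::ₘ I)) =
          ((LinearMap.mul ℝ (Smooth ι)).compr₂ (pds I)).compr₂ (pd i : Hom1 ι) := by
        ext1 f; ext1 g
        simp only [LinearMap.compr₂_apply, pds_cons, Derivation.coeFn_coe]
      rw [this]; exact C2diff_pd_comp i ih
  | zero =>
    have : (LinearMap.mul ℝ (Smooth ι)).compr₂ (0 : Hom1 ι) = 0 := by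
      ext1 f; ext1 g; simp
    rw [this]; exact zero_mem _
  | add D E _ _ h h' =>
    have : (LinearMap.mul ℝ (Smooth ι)).compr₂ (D + E) =
        (LinearMap.mul ℝ (Smooth ι)).compr₂ D + (LinearMap.mul ℝ (Smooth ι)).compr₂ E := by
      ext1 f; ext1 g; simp
    rw [this]; exact add_mem h h'
  | smul c D _ h =>
    have : (LinearMap.mul ℝ (Smooth ι)).compr₂ (c • D) =
        c • (LinearMap.mul ℝ (Smooth ι)).compr₂ D := by
      ext1 f; ext1 g; simp
    rw [this]; exact Submodule.smul_mem _ _ h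

theorem δ₁_mem {D : Hom1 ι} (hD : D ∈ C1diff ι) : δ₁ D ∈ C2diff ι := by
  refine add_mem (sub_mem ?_ (mul_comp_mem hD)) ?_
  · induction hD using Submodule.span_induction with
    | mem D hD =>
      obtain ⟨I, rfl⟩ := hD
      exact Submodule.subset_span ⟨(0, I), rfl⟩
    | zero =>
      have : cup LinearMap.id (0 : Hom1 ι) = 0 := by ext1 f; ext1 g; simp [cup_apply]
      rw [this]; exact zero_mem _
    | add D E _ _ h h' =>
      have : cup LinearMap.id (D + E) = cup LinearMap.id D + cup LinearMap.id E := by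
        ext1 f; ext1 g; simp [cup_apply, mul_add]
      rw [this]; exact add_mem h h'
    | smul c D _ h =>
      have : cup LinearMap.id (c • D) = c • cup LinearMap.id D := by
        ext1 f; ext1 g
        simp only [cup_apply, LinearMap.smul_apply, smul_eq_mul]
        ring
      rw [this]; exact Submodule.smul_mem _ _ h
  · induction hD using Submodule.span_induction with
    | mem D hD =>
      obtain ⟨I, rfl⟩ := hD
      exact Submodule.subset_span ⟨(I, 0), rfl⟩
    | zero =>
      have : cup (0 : Hom1 ι) LinearMap.id = 0 := by ext1 f; ext1 g; simp [cup_apply]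
      rw [this]; exact zero_mem _
    | add D E _ _ h h' =>
      have : cup (D + E) LinearMap.id = cup D LinearMap.id + cup E LinearMap.id := by
        ext1 f; ext1 g; simp [cup_apply, add_mul]
      rw [this]; exact add_mem h h'
    | smul c D _ h =>
      have : cup (c • D) LinearMap.id = c • cup D LinearMap.id := by
        ext1 f; ext1 g
        simp only [cup_apply, LinearMap.smul_apply, smul_eq_mul]
        ring
      rw [this]; exact Submodule.smul_mem _ _ h

theorem B2_le_Z2 : B2 ι ≤ Z2 ι := by
  rintro _ ⟨D, hD, rfl⟩
  exact ⟨δ₁_mem hD, δ₂_δ₁ D⟩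

/-! ### Bivector fields and the classical HKR map -/

/-- Bivector fields `X = ½ ∑_{i,j} X^{ij} ∂_i ∧ ∂_j` on `ℝ^ι`, given by their antisymmetric
coefficients `X^{ij} = X(dx^i, dx^j) ∈ C^∞(ℝ^ι)`. -/
def Bivec (ι : Type) [Fintype ι] : Submodule ℝ (ι → ι → Smooth ι) where
  carrier := {X | ∀ i j, X i j = -X j i}
  add_mem' hX hY i j := by simp only [Pi.add_apply, hX i j, hY i j]; ring
  zero_mem' i j := by simp
  smul_mem' c X hX i j := by simp only [Pi.smul_apply, hX i j, smul_neg]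

/-- The wedge product of two vector fields `Y = ∑ Y^i ∂_i` and `Z = ∑ Z^i ∂_i`,
`(Y ∧ Z)(df, dg) = Y(f) Z(g) - Y(g) Z(f)`. -/
def wedge {ι : Type} [Fintype ι] (Y Z : ι → Smooth ι) : Bivec ι :=
  ⟨fun i j => Y i * Z j - Y j * Z i, fun i j => by ring⟩

/-- The classical HKR map in degree two, `U(X)(f, g) = (1/2!) X(df, dg)`, where
`X(df, dg) = ∑_{i,j} X^{ij} ∂_i f ∂_j g`. -/
def U : Bivec ι →ₗ[ℝ] Hom2 ι where
  toFun X := (1 / 2 : ℝ) • ∑ i, ∑ j, X.1 i j • cup (pd i : Hom1 ι) (pd j : Hom1 ι)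
  map_add' X Y := by
    simp only [Submodule.coe_add, Pi.add_apply, add_smul, Finset.sum_add_distrib, smul_add]
  map_smul' c X := by
    simp only [Submodule.coe_smul, Pi.smul_apply, smul_assoc, ← Finset.smul_sum, RingHom.id_apply]
    rw [smul_comm]

theorem U_apply (X : Bivec ι) (f g : Smooth ι) :
    U X f g = (1 / 2 : ℝ) • ∑ i, ∑ j, X.1 i j * (pd i f * pd j g) := by
  simp [U, LinearMap.sum_apply, cup_apply]

theorem U_mem_C2diff (X : Bivec ι) : U X ∈ C2diff ι := by
  refine Submodule.smul_of_tower_mem _ _ (sum_mem fun i _ => sum_mem fun j _ =>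
    Submodule.smul_mem _ _ (Submodule.subset_span ⟨({i}, {j}), ?_⟩))
  ext1 f; ext1 g
  rw [cup_apply, cup_apply]
  congr 1

theorem U_mem_Z2 (X : Bivec ι) : U X ∈ Z2 ι := by
  refine ⟨U_mem_C2diff X, ?_⟩
  change δ₂ (U X) = 0
  simp only [U, LinearMap.coe_mk, AddHom.coe_mk, map_smul, map_sum]
  refine (congrArg _ (Finset.sum_eq_zero fun i _ => Finset.sum_eq_zero fun j _ => ?_)).trans
    (smul_zero _)
  funext f g h
  simp only [δ₂_apply, LinearMap.smul_apply, cup_apply, Derivation.coeFn_coe,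
    Derivation.leibniz, smul_eq_mul, Pi.zero_apply]
  ring

/-- The classical HKR map on cochains, `𝔛²(ℝ^ι) → C²_diff(C^∞(ℝ^ι))`. -/
def UC (ι : Type) [Fintype ι] [DecidableEq ι] :
    Bivec ι →ₗ[ℝ] (C2diff ι).restrictScalars ℝ :=
  U.codRestrict _ U_mem_C2diff

/-- The classical HKR map `𝔛²(ℝ^ι) → HH²_diff(C^∞(ℝ^ι))`. -/
def UHH (ι : Type) [Fintype ι] [DecidableEq ι] : Bivec ι →ₗ[ℝ] HH2diff ι :=
  ((B2 ι).submoduleOf (Z2 ι)).mkQ ∘ₗ U.codRestrict _ U_mem_Z2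

end Classical

/-! ### The constraint manifold `ℝ^n = (ℝ^{n_T}, ℝ^{n_N}, ℝ^{n_0})` -/

/-- The dimensions `n_0 ≤ n_N ≤ n_T` (with `n_0` written `O`). -/
structure ConDim where
  T : ℕ
  N : ℕ
  O : ℕ
  O_le_N : O ≤ N
  N_le_T : N ≤ T

namespace ConDim

variable (n : ConDim)

/-- `n_red = n_N - n_0`. -/
def red : ℕ := n.N - n.O

/-- The submanifold `ℝ^{n_N} ⊆ ℝ^{n_T}`, on which the last `n_T - n_N` coordinates vanish. The
distribution on it is spanned by `∂_i` for the first `n_0` coordinates. -/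
def sub : Set (Fin n.T → ℝ) := {x | ∀ i : Fin n.T, n.N ≤ i → x i = 0}

/-- The position `n_0 + j` in `{1, …, n_T}` of the `j`-th coordinate of `ℝ^{n_red}`. -/
def idx (j : Fin n.red) : Fin n.T :=
  ⟨n.O + j, by have := j.2; have := n.N_le_T; have := n.O_le_N; unfold red at *; omega⟩

/-- On `ℝ^{n_N}` this is the quotient map `π : ℝ^{n_N} → ℝ^{n_red}` which forgets the first `n_0`
coordinates. -/
def proj (x : Fin n.T → ℝ) : Fin n.red → ℝ := fun j => x (n.idx j)

end ConDim

variable (n : ConDim)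

/-- `ConC^∞(ℝ^n)_0`: the smooth functions vanishing on `ℝ^{n_N}`. -/
def funO : Submodule ℝ (Smooth (Fin n.T)) where
  carrier := {f | ∀ x ∈ n.sub, f x = 0}
  add_mem' hf hg x hx := by
    rw [Smooth.add_apply, hf x hx, hg x hx, add_zero]
  zero_mem' _ _ := rfl
  smul_mem' c f hf x hx := by
    rw [Smooth.smul_apply, hf x hx, mul_zero]

/-- `ConC^∞(ℝ^n)_N`: the smooth functions on `ℝ^{n_T}` whose restriction to `ℝ^{n_N}` is constant
along the distribution. -/
def funN : Submodule ℝ (Smooth (Fin n.T)) where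
  carrier := {f | ∀ i : Fin n.T, (i : ℕ) < n.O → pd i f ∈ funO n}
  add_mem' hf hg i hi := by rw [map_add]; exact add_mem (hf i hi) (hg i hi)
  zero_mem' i _ := by rw [map_zero]; exact zero_mem _
  smul_mem' c f hf i hi := by
    rw [Derivation.map_smul]; exact Submodule.smul_mem _ _ (hf i hi)

variable {n}

theorem mul_funO (f : Smooth (Fin n.T)) {g : Smooth (Fin n.T)} (hg : g ∈ funO n) :
    f * g ∈ funO n := fun x hx => by
  rw [Smooth.mul_apply, hg x hx, mul_zero]

theorem funO_mul (f : Smooth (Fin n.T)) {g : Smooth (Fin n.T)} (hg : g ∈ funO n) :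
    g * f ∈ funO n := mul_comm f g ▸ mul_funO f hg

theorem pd_funO {i : Fin n.T} (hi : (i : ℕ) < n.N) {f : Smooth (Fin n.T)} (hf : f ∈ funO n) :
    pd i f ∈ funO n := by
  intro x hx
  have h1 : HasDerivAt (fun t : ℝ => f (x + t • (Pi.single i 1 : Fin n.T → ℝ)))
      (fderiv ℝ f x (Pi.single i 1)) 0 := by
    have hd : HasFDerivAt f (fderiv ℝ f x) (x + (0 : ℝ) • (Pi.single i 1 : Fin n.T → ℝ)) := by
      simpa using (f.diff x).hasFDerivAt
    have hl : HasDerivAt (fun t : ℝ => x + t • (Pi.single i 1 : Fin n.T → ℝ))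
        (Pi.single i 1) 0 := by
      simpa using ((hasDerivAt_id (0 : ℝ)).smul_const (Pi.single i 1 : Fin n.T → ℝ)).const_add x
    exact hd.comp_hasDerivAt (0 : ℝ) hl
  have h2 : (fun t : ℝ => f (x + t • (Pi.single i 1 : Fin n.T → ℝ))) = fun _ => 0 := by
    funext t
    refine hf _ fun j hj => ?_
    have hji : j ≠ i := by rintro rfl; omega
    simp [hx j hj, Pi.single_eq_of_ne hji]
  rw [h2] at h1
  exact h1.unique (hasDerivAt_const _ _)

theorem funO_le_funN : funO n ≤ funN n := fun _ hf _ hi =>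
  pd_funO (lt_of_lt_of_le hi n.O_le_N) hf

theorem mul_funN {f g : Smooth (Fin n.T)} (hf : f ∈ funN n) (hg : g ∈ funN n) :
    f * g ∈ funN n := fun i hi => by
  rw [Derivation.leibniz]
  exact add_mem (mul_funO _ (hg i hi)) (mul_funO _ (hf i hi))

theorem pd_funN {i : Fin n.T} (hi : (i : ℕ) < n.N) {f : Smooth (Fin n.T)} (hf : f ∈ funN n) :
    pd i f ∈ funN n := fun j hj => by
  rw [pd_comm]; exact pd_funO hi (hf j hj)

variable (n)

/-! ### Constraint cochains and constraint Hochschild cohomology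

The constraint algebra of functions is embedded, so that the `N`-component of a constraint cochain
is the restriction of its `T`-component: constraint cochains are the multidifferential operators on
`ℝ^{n_T}` which are compatible with the `N`- and the `0`-component of the functions. -/

/-- `C¹_diff(ConC^∞(ℝ^n))_N`. -/
def C1N : Submodule ℝ (Hom1 (Fin n.T)) where
  carrier := {D | D ∈ C1diff (Fin n.T) ∧ (∀ f ∈ funN n, D f ∈ funN n) ∧
    (∀ f ∈ funO n, D f ∈ funO n)}
  add_mem' {_ _} hD hE := ⟨add_mem hD.1 hE.1, fun f hf => add_mem (hD.2.1 f hf) (hE.2.1 f hf),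
    fun f hf => add_mem (hD.2.2 f hf) (hE.2.2 f hf)⟩
  zero_mem' := ⟨zero_mem _, fun _ _ => zero_mem _, fun _ _ => zero_mem _⟩
  smul_mem' c _ hD := ⟨Submodule.smul_of_tower_mem _ c hD.1,
    fun f hf => Submodule.smul_mem _ c (hD.2.1 f hf),
    fun f hf => Submodule.smul_mem _ c (hD.2.2 f hf)⟩

/-- `C²_diff(ConC^∞(ℝ^n))_N`. -/
def C2N : Submodule ℝ (Hom2 (Fin n.T)) where
  carrier := {B | B ∈ C2diff (Fin n.T) ∧ (∀ f ∈ funN n, ∀ g ∈ funN n, B f g ∈ funN n) ∧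
    (∀ f ∈ funO n, ∀ g ∈ funN n, B f g ∈ funO n) ∧
    (∀ f ∈ funN n, ∀ g ∈ funO n, B f g ∈ funO n)}
  add_mem' hB hC := ⟨add_mem hB.1 hC.1,
    fun f hf g hg => add_mem (hB.2.1 f hf g hg) (hC.2.1 f hf g hg),
    fun f hf g hg => add_mem (hB.2.2.1 f hf g hg) (hC.2.2.1 f hf g hg),
    fun f hf g hg => add_mem (hB.2.2.2 f hf g hg) (hC.2.2.2 f hf g hg)⟩
  zero_mem' := ⟨zero_mem _, fun _ _ _ _ => zero_mem _, fun _ _ _ _ => zero_mem _,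
    fun _ _ _ _ => zero_mem _⟩
  smul_mem' c _ hB := ⟨Submodule.smul_of_tower_mem _ c hB.1,
    fun f hf g hg => Submodule.smul_mem _ c (hB.2.1 f hf g hg),
    fun f hf g hg => Submodule.smul_mem _ c (hB.2.2.1 f hf g hg),
    fun f hf g hg => Submodule.smul_mem _ c (hB.2.2.2 f hf g hg)⟩

/-- `C²_diff(ConC^∞(ℝ^n))_0`. -/
def C2O : Submodule ℝ (Hom2 (Fin n.T)) where
  carrier := {B | B ∈ C2N n ∧ ∀ f ∈ funN n, ∀ g ∈ funN n, B f g ∈ funO n}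
  add_mem' hB hC := ⟨add_mem hB.1 hC.1,
    fun f hf g hg => add_mem (hB.2 f hf g hg) (hC.2 f hf g hg)⟩
  zero_mem' := ⟨zero_mem _, fun _ _ _ _ => zero_mem _⟩
  smul_mem' c _ hB := ⟨Submodule.smul_mem _ c hB.1,
    fun f hf g hg => Submodule.smul_mem _ c (hB.2 f hf g hg)⟩

variable {n}

theorem mem_C2O {B : Hom2 (Fin n.T)} (hB : B ∈ C2diff (Fin n.T))
    (h : ∀ f ∈ funN n, ∀ g ∈ funN n, B f g ∈ funO n) : B ∈ C2O n :=
  ⟨⟨hB, fun f hf g hg => funO_le_funN (h f hf g hg),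
    fun f hf g hg => h f (funO_le_funN hf) g hg,
    fun f hf g hg => h f hf g (funO_le_funN hg)⟩, h⟩

theorem C2O_le_C2N : C2O n ≤ C2N n := fun _ h => h.1

theorem C2N_le : C2N n ≤ (C2diff (Fin n.T)).restrictScalars ℝ := fun _ h => h.1

variable (n)

/-- The constraint module `C²_diff(ConC^∞(ℝ^n))`. -/
def conC2 : ConModule where
  T := (C2diff (Fin n.T)).restrictScalars ℝ
  N := C2N n
  O := (C2O n).submoduleOf (C2N n)
  ι := Submodule.inclusion C2N_le

/-- Constraint `2`-cocycles, `ker δ_N`. -/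
def Z2N : Submodule ℝ (Hom2 (Fin n.T)) := C2N n ⊓ LinearMap.ker δ₂

/-- Constraint `2`-coboundaries, `im δ_N`. -/
def B2N : Submodule ℝ (Hom2 (Fin n.T)) := (C1N n).map δ₁

variable {n}

theorem Z2N_le : Z2N n ≤ Z2 (Fin n.T) := inf_le_inf_right _ C2N_le

theorem B2N_le : B2N n ≤ B2 (Fin n.T) := Submodule.map_mono fun _ h => h.1

theorem B2N_le_Z2N : B2N n ≤ Z2N n := by
  rintro _ ⟨D, hD, rfl⟩
  refine ⟨⟨δ₁_mem hD.1, fun f hf g hg => ?_, fun f hf g hg => ?_, fun f hf g hg => ?_⟩, δ₂_δ₁ D⟩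
  · exact add_mem (sub_mem (mul_funN hf (hD.2.1 g hg)) (hD.2.1 _ (mul_funN hf hg)))
      (mul_funN (hD.2.1 f hf) hg)
  · exact add_mem (sub_mem (funO_mul _ hf) (hD.2.2 _ (funO_mul _ hf)))
      (funO_mul _ (hD.2.2 f hf))
  · exact add_mem (sub_mem (mul_funO _ (hD.2.2 g hg)) (hD.2.2 _ (mul_funO _ hg)))
      (mul_funO _ hg)

variable (n)

/-- The constraint module `HH²_diff(ConC^∞(ℝ^n)) = ker δ / im δ`: its `T`-component is
`HH²_diff(C^∞(ℝ^{n_T}))`, its `N`-component is `ker δ_N / im δ_N`, and its `0`-component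
consists of the classes of the cocycles in `C²_diff(ConC^∞(ℝ^n))_0`. -/
def conHH2 : ConModule where
  T := HH2diff (Fin n.T)
  N := Z2N n ⧸ (B2N n).submoduleOf (Z2N n)
  O := ((C2O n).submoduleOf (Z2N n)).map ((B2N n).submoduleOf (Z2N n)).mkQ
  ι := Submodule.mapQ _ _ (Submodule.inclusion Z2N_le) fun _ hx => B2N_le hx

/-! ### Extended constraint bivector fields -/

/-- The `0`-component of the constraint vector fields `Y = ∑ Y^i ∂_i` on `ℝ^n`: along `ℝ^{n_N}` they
take values in the distribution. -/
def vecO : Set (Fin n.T → Smooth (Fin n.T)) :=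
  {Y | ∀ i : Fin n.T, n.O ≤ i → Y i ∈ funO n}

/-- The `N`-component of the constraint vector fields `Y = ∑ Y^i ∂_i` on `ℝ^n`: they are tangent to
`ℝ^{n_N}`, and there their bracket with `∂_j` lies in the distribution for `j ≤ n_0`. -/
def vecN : Set (Fin n.T → Smooth (Fin n.T)) :=
  {Y | (∀ i : Fin n.T, n.N ≤ i → Y i ∈ funO n) ∧
    ∀ i : Fin n.T, n.O ≤ i → (i : ℕ) < n.N → Y i ∈ funN n}

/-- The `0`-component of the constraint bivector fields for the strong tensor product,
spanned by `Γ_0 ∧ Γ_T`. -/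
def bivecO : Submodule ℝ (Bivec (Fin n.T)) :=
  Submodule.span ℝ {X | ∃ Y ∈ vecO n, ∃ Z, X = wedge Y Z}

/-- The `N`-component of the constraint bivector fields for the strong tensor product,
spanned by `Γ_N ∧ Γ_N` and `Γ_0 ∧ Γ_T`. -/
def bivecN : Submodule ℝ (Bivec (Fin n.T)) :=
  Submodule.span ℝ {X | ∃ Y ∈ vecN n, ∃ Z ∈ vecN n, X = wedge Y Z} ⊔ bivecO n

/-- The monomials `∂_{i_1} ∨ ⋯ ∨ ∂_{i_k} ∨ ∂_t` with `k ≥ 1`, `i_1, …, i_k ≤ n_0`, `t > n_N`. -/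
def extMonomials : Set (Fin n.T →₀ ℕ) :=
  {m | ∃ (k : Fin n.T →₀ ℕ) (t : Fin n.T), k ≠ 0 ∧ (∀ i, k i ≠ 0 → (i : ℕ) < n.O) ∧
    n.N ≤ t ∧ m = k + Finsupp.single t 1}

/-- `⨁_{k ≥ 1} Sym^k Γ(Tℝ^{n_0}|_{ℝ^{n_N}}) ∨ Γ(Tℝ^{n_T-n_N}|_{ℝ^{n_N}})`. Here the symmetric
algebra over `C^∞(ℝ^{n_N})` of the free module `Γ(Tℝ^{n_T}|_{ℝ^{n_N}})` with basis `∂_i` is the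
polynomial ring over `C^∞(ℝ^{n_N})` in the variables `X i = ∂_i`. -/
def symExt : Submodule ℝ (MvPolynomial (Fin n.T) (Smooth (Fin n.N))) where
  carrier := {D | ∀ m, MvPolynomial.coeff m D ≠ 0 → m ∈ extMonomials n}
  add_mem' {D E} hD hE m hm := by
    by_contra h
    refine hm ?_
    rw [MvPolynomial.coeff_add, not_not.1 fun h' => h (hD m h'), not_not.1 fun h' => h (hE m h'),
      add_zero]
  zero_mem' m hm := by simp at hm
  smul_mem' c D hD m hm := by
    refine hD m fun h => hm ?_
    rw [MvPolynomial.coeff_smul, h, smul_zero]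

/-- `prol : C^∞(ℝ^{n_N}) → C^∞(ℝ^{n_T})`, the constant extension of functions. -/
def prol : Smooth (Fin n.N) →ₗ[ℝ] Smooth (Fin n.T) := Smooth.pull (Fin.castLE n.N_le_T)

/-- `Op(prol(D)) = ∑_I prol(D^I) ∂_I` for `D = ∑_I D^I ∂_{i_1} ∨ ⋯ ∨ ∂_{i_r}`. -/
def opProl : MvPolynomial (Fin n.T) (Smooth (Fin n.N)) →ₗ[ℝ] Hom1 (Fin n.T) where
  toFun D := ∑ᶠ m, prol n (MvPolynomial.coeff m D) • pds (Finsupp.toMultiset m)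
  map_add' D E := by
    rw [← finsum_add_distrib]
    · refine finsum_congr fun m => ?_
      rw [MvPolynomial.coeff_add, map_add, add_smul]
    · refine D.support.finite_toSet.subset fun m hm => ?_
      rw [Finset.mem_coe, MvPolynomial.mem_support_iff]
      rintro h
      simp [h] at hm
    · refine E.support.finite_toSet.subset fun m hm => ?_
      rw [Finset.mem_coe, MvPolynomial.mem_support_iff]
      rintro h
      simp [h] at hm
  map_smul' c D := by
    rw [RingHom.id_apply, smul_finsum]
    refine finsum_congr fun m => ?_
    rw [MvPolynomial.coeff_smul, map_smul, smul_assoc]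

/-- The constraint module of extended constraint bivector fields. -/
def conXext : ConModule where
  T := Bivec (Fin n.T)
  N := bivecN n × symExt n
  O := ((bivecO n).submoduleOf (bivecN n)).prod ⊤
  ι := (bivecN n).subtype ∘ₗ LinearMap.fst ℝ (bivecN n) (symExt n)

variable {n}

/-- The action of a vector field on functions. -/
def act (Y : Fin n.T → Smooth (Fin n.T)) (f : Smooth (Fin n.T)) : Smooth (Fin n.T) :=
  ∑ i, Y i * pd i f

theorem vecO_act {Y : Fin n.T → Smooth (Fin n.T)} (hY : Y ∈ vecO n) {f : Smooth (Fin n.T)}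
    (hf : f ∈ funN n) : act Y f ∈ funO n := by
  refine sum_mem fun i _ => ?_
  by_cases hi : (i : ℕ) < n.O
  · exact mul_funO _ (hf i hi)
  · exact funO_mul _ (hY i (not_lt.1 hi))

theorem vecN_act_O {Y : Fin n.T → Smooth (Fin n.T)} (hY : Y ∈ vecN n) {f : Smooth (Fin n.T)}
    (hf : f ∈ funO n) : act Y f ∈ funO n := by
  refine sum_mem fun i _ => ?_
  by_cases hi : (i : ℕ) < n.N
  · exact mul_funO _ (pd_funO hi hf)
  · exact funO_mul _ (hY.1 i (not_lt.1 hi))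

theorem vecN_act_N {Y : Fin n.T → Smooth (Fin n.T)} (hY : Y ∈ vecN n) {f : Smooth (Fin n.T)}
    (hf : f ∈ funN n) : act Y f ∈ funN n := by
  refine sum_mem fun i _ => ?_
  by_cases hi : (i : ℕ) < n.N
  · by_cases hi' : (i : ℕ) < n.O
    · exact funO_le_funN (mul_funO _ (hf i hi'))
    · exact mul_funN (hY.2 i (not_lt.1 hi') hi) (pd_funN hi hf)
  · exact funO_le_funN (funO_mul _ (hY.1 i (not_lt.1 hi)))

theorem U_wedge (Y Z : Fin n.T → Smooth (Fin n.T)) (f g : Smooth (Fin n.T)) :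
    U (wedge Y Z) f g = (1 / 2 : ℝ) • (act Y f * act Z g - act Y g * act Z f) := by
  rw [U_apply]
  congr 1
  have h1 : act Y f * act Z g = ∑ i, ∑ j, (Y i * pd i f) * (Z j * pd j g) := by
    rw [act, act, Finset.sum_mul_sum]
  have h2 : act Y g * act Z f = ∑ i, ∑ j, (Y j * pd j g) * (Z i * pd i f) := by
    rw [Finset.sum_comm, act, act, Finset.sum_mul_sum]
  rw [h1, h2, ← Finset.sum_sub_distrib]
  refine Finset.sum_congr rfl fun i _ => ?_
  rw [← Finset.sum_sub_distrib]
  refine Finset.sum_congr rfl fun j _ => ?_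
  simp only [wedge]
  ring

theorem U_bivecO {X : Bivec (Fin n.T)} (hX : X ∈ bivecO n) : U X ∈ C2O n := by
  have : bivecO n ≤ (C2O n).comap U := by
    refine Submodule.span_le.2 ?_
    rintro _ ⟨Y, hY, Z, rfl⟩
    refine mem_C2O (U_mem_C2diff _) fun f hf g hg => ?_
    rw [U_wedge]
    exact Submodule.smul_mem _ _ (sub_mem (funO_mul _ (vecO_act hY hf))
      (funO_mul _ (vecO_act hY hg)))
  exact this hX

theorem U_bivecN {X : Bivec (Fin n.T)} (hX : X ∈ bivecN n) : U X ∈ C2N n := by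
  have : bivecN n ≤ (C2N n).comap U := by
    refine sup_le (Submodule.span_le.2 ?_) fun X hX => C2O_le_C2N (U_bivecO hX)
    rintro _ ⟨Y, hY, Z, hZ, rfl⟩
    refine ⟨U_mem_C2diff _, fun f hf g hg => ?_, fun f hf g hg => ?_, fun f hf g hg => ?_⟩
    · rw [U_wedge]
      exact Submodule.smul_mem _ _ (sub_mem (mul_funN (vecN_act_N hY hf) (vecN_act_N hZ hg))
        (mul_funN (vecN_act_N hY hg) (vecN_act_N hZ hf)))
    · rw [U_wedge]
      exact Submodule.smul_mem _ _ (sub_mem (funO_mul _ (vecN_act_O hY hf))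
        (mul_funO _ (vecN_act_O hZ hf)))
    · rw [U_wedge]
      exact Submodule.smul_mem _ _ (sub_mem (mul_funO _ (vecN_act_O hZ hg))
        (funO_mul _ (vecN_act_O hY hg)))
  exact this hX

/-- A property of `Op(prol(D))` which is closed under sums can be checked on the summands. -/
theorem opProl_induction {p : Hom1 (Fin n.T) → Prop}
    {D : MvPolynomial (Fin n.T) (Smooth (Fin n.N))} (h0 : p 0)
    (hadd : ∀ P Q, p P → p Q → p (P + Q))
    (h : ∀ m, p (prol n (MvPolynomial.coeff m D) • pds (Finsupp.toMultiset m))) :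
    p (opProl n D) :=
  finsum_induction p h0 (fun {P Q} hP hQ => hadd P Q hP hQ) h

theorem opProl_mem (D : MvPolynomial (Fin n.T) (Smooth (Fin n.N))) :
    opProl n D ∈ C1diff (Fin n.T) :=
  opProl_induction (zero_mem _) (fun _ _ => add_mem)
    fun _ => Submodule.smul_mem _ _ (Submodule.subset_span ⟨_, rfl⟩)

/-- Iterated derivatives along the distribution are linear over `ConC^∞(ℝ^n)_N`
up to functions vanishing on `ℝ^{n_N}`. -/
theorem pds_mul_funN {I : Multiset (Fin n.T)} (hI : ∀ i ∈ I, (i : ℕ) < n.O)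
    (u : Smooth (Fin n.T)) {g : Smooth (Fin n.T)} (hg : g ∈ funN n) :
    pds I (u * g) - pds I u * g ∈ funO n := by
  induction I using Multiset.induction_on with
  | empty => simp [pds_zero]
  | cons i I ih =>
    have hi : (i : ℕ) < n.O := hI i (Multiset.mem_cons_self i I)
    have h1 := pd_funO (lt_of_lt_of_le hi n.O_le_N)
      (ih fun j hj => hI j (Multiset.mem_cons_of_mem hj))
    have h2 := mul_funO (pds I u) (hg i hi)
    rw [pds_cons, pds_cons]
    have : pd i (pds I (u * g)) - pd i (pds I u) * g =
        pd i (pds I (u * g) - pds I u * g) + pds I u * pd i g := by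
      simp only [map_sub, Derivation.leibniz, smul_eq_mul]
      ring
    rw [this]
    exact add_mem h1 h2

theorem pds_add (I J : Multiset (Fin n.T)) (f : Smooth (Fin n.T)) :
    pds (I + J) f = pds I (pds J f) := by
  induction I using Multiset.induction_on with
  | empty => simp [pds_zero]
  | cons i I ih => rw [Multiset.cons_add, pds_cons, pds_cons, ih]

theorem δ₁_pds_mem (c : Smooth (Fin n.T)) {I : Multiset (Fin n.T)}
    (hI : ∀ i ∈ I, (i : ℕ) < n.O) (t : Fin n.T) {f g : Smooth (Fin n.T)}
    (hf : f ∈ funN n) (hg : g ∈ funN n) : δ₁ (c • pds (I + {t})) f g ∈ funO n := by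
  have h1 := pds_mul_funN hI (pd t f) hg
  have h2 := pds_mul_funN hI (pd t g) hf
  have hp : ∀ h : Smooth (Fin n.T), (c • pds (I + {t})) h = c * pds I (pd t h) := by
    intro h
    rw [LinearMap.smul_apply, pds_add, smul_eq_mul, ← Multiset.cons_zero, pds_cons, pds_zero]
  have hl : pd t (f * g) = pd t g * f + pd t f * g := by
    rw [Derivation.leibniz, smul_eq_mul, smul_eq_mul]
    ring
  have : δ₁ (c • pds (I + {t})) f g =
      -(c * ((pds I (pd t f * g) - pds I (pd t f) * g) +
        (pds I (pd t g * f) - pds I (pd t g) * f))) := by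
    rw [δ₁_apply, hp, hp, hp, hl, map_add]
    ring
  rw [this]
  exact neg_mem (mul_funO _ (add_mem h1 h2))

theorem δ₁_opProl_mem {D : MvPolynomial (Fin n.T) (Smooth (Fin n.N))} (hD : D ∈ symExt n) :
    δ₁ (opProl n D) ∈ C2O n := by
  refine mem_C2O (δ₁_mem (opProl_mem D)) fun f hf g hg => ?_
  refine opProl_induction (p := fun P => δ₁ P f g ∈ funO n) ?_ ?_ fun m => ?_
  · rw [map_zero]; exact zero_mem _
  · intro P Q hP hQ
    rw [map_add]; exact add_mem hP hQ
  · by_cases hm : MvPolynomial.coeff m D = 0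
    · rw [hm, map_zero, zero_smul, map_zero]; exact zero_mem _
    obtain ⟨k, t, -, hk, -, rfl⟩ := hD m hm
    rw [map_add Finsupp.toMultiset, Finsupp.toMultiset_single, one_smul]
    exact δ₁_pds_mem _ (fun i hi => hk i (by simpa using hi)) t hf hg

variable (n)

/-- The `N`-component of the extended constraint HKR map before passing to cohomology:
`(X, D) ↦ U(X) + δ(Op(prol(D)))`. -/
def UextN : (bivecN n × symExt n) →ₗ[ℝ] Hom2 (Fin n.T) :=
  (U ∘ₗ (bivecN n).subtype).coprod (δ₁ ∘ₗ opProl n ∘ₗ (symExt n).subtype)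

variable {n}

theorem UextN_apply (X : bivecN n) (D : symExt n) :
    UextN n (X, D) = U X.1 + δ₁ (opProl n D.1) := rfl

theorem UextN_mem (p : bivecN n × symExt n) : UextN n p ∈ Z2N n :=
  ⟨add_mem (U_bivecN p.1.2) (C2O_le_C2N (δ₁_opProl_mem p.2.2)),
    (LinearMap.ker δ₂).add_mem (U_mem_Z2 _).2 (δ₂_δ₁ _)⟩

theorem UextN_mem_O {p : bivecN n × symExt n} (hp : p.1.1 ∈ bivecO n) : UextN n p ∈ C2O n :=
  add_mem (U_bivecO hp) (δ₁_opProl_mem p.2.2)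

variable (n)

/-- The extended constraint HKR map on cochains, `X ↦ U(X)` on the `T`-component and
`(X, D) ↦ U(X) + δ(Op(prol(D)))` on the `N`-component. The two components agree under the maps
`ι` only up to coboundaries, but the reduction only involves the `N`-component. -/
def UextC : ConPair (conXext n) (conC2 n) where
  T := UC (Fin n.T)
  N := (UextN n).codRestrict (C2N n) fun p => (UextN_mem p).1
  map_O _ hp := UextN_mem_O hp.1

/-- The extended constraint HKR map in cohomology, a morphism of constraint modules. -/
def UextHH : ConHom (conXext n) (conHH2 n) where
  T := UHH (Fin n.T)
  N := ((B2N n).submoduleOf (Z2N n)).mkQ ∘ₗ (UextN n).codRestrict (Z2N n) UextN_mem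
  map_O p hp := ⟨⟨UextN n p, UextN_mem p⟩, UextN_mem_O hp.1, rfl⟩
  comm p := by
    refine (Submodule.Quotient.eq _).2 ?_
    refine ⟨opProl n p.2.1, opProl_mem _, ?_⟩
    change δ₁ (opProl n p.2.1) = (U p.1.1 + δ₁ (opProl n p.2.1)) - U p.1.1
    abel

/-! ### Reduction to `ℝ^{n_red}` -/

/-- `f` reduces to `a`: `f|_{ℝ^{n_N}} = π^* a`. -/
def FunReduces (f : Smooth (Fin n.T)) (a : Smooth (Fin n.red)) : Prop :=
  ∀ x ∈ n.sub, f x = a (n.proj x)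

/-- `X` reduces to `Y`: `Λ²Tπ ∘ X|_{ℝ^{n_N}} = Y ∘ π`, in coordinates. -/
def BivecReduces (X : Bivec (Fin n.T)) (Y : Bivec (Fin n.red)) : Prop :=
  ∀ i j, FunReduces n (X.1 (n.idx i) (n.idx j)) (Y.1 i j)

/-- `B` reduces to `b`: if `f, g` reduce to `a, a'`, then `B(f, g)` reduces to `b(a, a')`. -/
def CochainReduces (B : Hom2 (Fin n.T)) (b : Hom2 (Fin n.red)) : Prop :=
  ∀ f g a a', FunReduces n f a → FunReduces n g a' → FunReduces n (B f g) (b a a')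

end ConstraintHKR

end

open ConstraintHKR

/-! The proof reads everything off from full symbols. Evaluating a differential or bidifferential
operator at `x` on the monomials `(y - x)^I` (`symb₁`, `symb₂`) gives its coefficients up to
factorials, and these determine the operator (`C2diff_eq_zero`). A nonempty centred monomial
vanishes at `x`, so the cocycle equation becomes combinatorial: between nonempty multi-indices,
elements may be moved from one argument of `symb₂ B` to the other (`symb₂_cocycle_assoc`). Hence the
symmetric part of the symbol depends only on `I + J` and comes from a coboundary, while the
antisymmetric part vanishes unless both arguments are singletons and comes from a bivector field.
Thus `B = U X + δ₁ D` with `D` free of first-order terms (`exists_U_add_δ₁`), which is the classical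
HKR theorem in degree two.

For a constraint cocycle, testing on the centred monomials that lie in `funN` or `funO` puts `X`
into `bivecN`. Then `δ₁ D` is a constraint cochain, and splitting a multi-index `M` into two
nonempty parts carries the constraint conditions over to the coefficient of `∂_M` in `D`. This fails
only if `M` consists of one transversal index and a nonempty family of distribution indices: the
part without the transversal index then contains distribution indices only, and its monomial is not
in `funN`. These are the monomials of `symExt`. So `D` is a constraint operator plus some `opProl n
S` (`exists_opProl_add`), and `S` is determined by the cohomology class (`symExt_eq_zero`).

For the reduction, functions on `ℝ^{n_red}` are extended constantly, the cochain is applied, and the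
result is restricted to a slice. On `C2N n` the kernel of this map is `C2O n`
(`reduce_eq_zero_iff`); the map commutes with `δ₁` and `U` and kills `δ₁ (opProl n D)` for `D` in
`symExt n`, so the reduced extended map is the classical one. Lifts of operators and bivector fields
from `ℝ^{n_red}` give surjectivity. -/

noncomputable section

namespace ConstraintHKR

/-! ### Combinatorics of functions of two multisets -/

section MultisetFunctions

/-- Two decompositions of a multiset have a common refinement. -/
theorem exists_common_refinement {ι : Type*} [DecidableEq ι] {I K I' K' : Multiset ι}
    (h : I + K = I' + K') :
    ∃ A B C E, I = A + B ∧ K = C + E ∧ I' = A + C ∧ K' = B + E := by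
  have hc : ∀ i, I.count i + K.count i = I'.count i + K'.count i := fun i => by
    rw [← Multiset.count_add, h, Multiset.count_add]
  -- The pieces are the intersections of an old part with a new one. Pointwise `I' - I ≤ K` because
  -- `I' ≤ I + K`, so no truncated subtraction loses anything.
  refine ⟨I ∩ I', I - I', I' - I, K - (I' - I), ?_, ?_, ?_, ?_⟩ <;>
  · ext i
    have := hc i
    simp only [Multiset.count_add, Multiset.count_inter, Multiset.count_sub]
    omega

/-- A symmetric function of two non-empty multisets which allows to move elements from one argument
to the other only depends on the sum of the arguments. -/
theorem eq_of_add_eq {ι : Type*} [DecidableEq ι] {s : Multiset ι → Multiset ι → ℝ}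
    (hsymm : ∀ I J, s I J = s J I)
    (hs : ∀ I J K, I ≠ 0 → K ≠ 0 → s (I + J) K = s I (J + K)) {I K I' K' : Multiset ι}
    (hI : I ≠ 0) (hK : K ≠ 0) (hI' : I' ≠ 0) (hK' : K' ≠ 0) (h : I + K = I' + K') :
    s I K = s I' K' := by
  obtain ⟨A, B, C, E, rfl, rfl, rfl, rfl⟩ := exists_common_refinement h
  -- Now `I = A + B`, `K = C + E`, `I' = A + C`, `K' = B + E`. A nonempty `A` or `E` serves as the
  -- fixed anchor past which `B` and `C` are moved. If both are empty, the two splittings are swaps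
  -- of each other and symmetry is used.
  by_cases hA : A = 0
  · subst hA
    rw [zero_add] at hI hI' ⊢
    rw [zero_add]
    by_cases hE : E = 0
    · subst hE
      rw [add_zero, add_zero, hsymm]
    · rw [← hs _ _ _ hI hE, add_comm B C, hs _ _ _ hI' hE]
  · by_cases hE : E = 0
    · subst hE
      rw [add_zero] at hK hK' ⊢
      rw [add_zero, add_comm A B, hs _ _ _ hK' hK, hsymm]
    · rw [hs _ _ _ hA hK, hs _ _ _ hA hK', add_left_comm]

/-- An antisymmetric function of two non-empty multisets which allows to move elements from one
argument to the other vanishes unless both arguments are singletons. -/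
theorem eq_zero_of_card {ι : Type*} {a : Multiset ι → Multiset ι → ℝ}
    (hanti : ∀ I J, a I J = -a J I)
    (ha : ∀ I J K, I ≠ 0 → K ≠ 0 → a (I + J) K = a I (J + K)) {I K : Multiset ι}
    (hI : I ≠ 0) (hK : K ≠ 0) (h : I.card ≠ 1 ∨ K.card ≠ 1) : a I K = 0 := by
  have key : ∀ I K : Multiset ι, I ≠ 0 → K ≠ 0 → I.card ≠ 1 → a I K = 0 := by
    intro I K hI hK h
    obtain ⟨i, hi⟩ := Multiset.exists_mem_of_ne_zero hI
    obtain ⟨L, rfl⟩ := Multiset.exists_cons_of_mem hi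
    have hL : L ≠ 0 := by rintro rfl; simp at h
    have hi0 : ({i} : Multiset ι) ≠ 0 := Multiset.singleton_ne_zero i
    rw [← Multiset.singleton_add]
    -- The three nonempty blocks `{i}`, `L`, `K` are rotated cyclically. This makes `a` symmetric at
    -- these arguments as well as antisymmetric; `L ≠ 0` is where the cardinality assumption enters.
    have h1 : a ({i} + L) K = a K ({i} + L) := by
      rw [ha _ _ _ hi0 hK, add_comm L K, ← ha _ _ _ hi0 hL, add_comm _ K, ha _ _ _ hK hL]
    have h2 := hanti ({i} + L) K
    linarith
  rcases h with h | h
  · exact key I K hI hK h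
  · rw [hanti, key K I hK hI h, neg_zero]

end MultisetFunctions

/-! ### Full symbols of differential and bidifferential operators -/

section Symbols

variable {ι : Type} [Fintype ι]

/-- Evaluation at a point. -/
def Smooth.eval (x : ι → ℝ) : Smooth ι →ₐ[ℝ] ℝ where
  toFun f := f x
  map_one' := rfl
  map_mul' _ _ := rfl
  map_zero' := rfl
  map_add' _ _ := rfl
  commutes' _ := rfl

theorem Smooth.eval_apply (x : ι → ℝ) (f : Smooth ι) : Smooth.eval x f = f x := rfl

theorem Smooth.sub_apply (f g : Smooth ι) (x : ι → ℝ) : (f - g) x = f x - g x := rfl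

theorem Smooth.neg_apply (f : Smooth ι) (x : ι → ℝ) : (-f) x = -f x := rfl

theorem Smooth.sum_apply {α : Type*} (s : Finset α) (f : α → Smooth ι) (x : ι → ℝ) :
    (∑ a ∈ s, f a) x = ∑ a ∈ s, f a x := map_sum (Smooth.eval x) f s

/-- The coordinate function `y ↦ y_i - x_i` centred at `x`. -/
def centredCoord (x : ι → ℝ) (i : ι) : Smooth ι :=
  Smooth.mk (fun y => y i - x i) ((contDiff_apply ℝ ℝ i).sub contDiff_const)

theorem centredCoord_apply (x y : ι → ℝ) (i : ι) : centredCoord x i y = y i - x i := rfl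

/-- The monomial `y ↦ ∏_{i ∈ I} (y_i - x_i)` centred at `x`. -/
def centredMonomial (x : ι → ℝ) (I : Multiset ι) : Smooth ι := (I.map (centredCoord x)).prod

theorem centredMonomial_zero (x : ι → ℝ) : centredMonomial x 0 = 1 := by
  simp [centredMonomial]

theorem centredMonomial_cons (x : ι → ℝ) (i : ι) (I : Multiset ι) :
    centredMonomial x (i ::ₘ I) = centredCoord x i * centredMonomial x I := by
  simp [centredMonomial]

theorem centredMonomial_add (x : ι → ℝ) (I J : Multiset ι) :
    centredMonomial x (I + J) = centredMonomial x I * centredMonomial x J := by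
  simp [centredMonomial]

/-- The coefficients of the full symbol of a differential operator, scaled by factorials. -/
def symb₁ (D : Hom1 ι) (I : Multiset ι) (x : ι → ℝ) : ℝ := D (centredMonomial x I) x

/-- The coefficients of the full symbol of a bidifferential operator, scaled by factorials. -/
def symb₂ (B : Hom2 ι) (I J : Multiset ι) (x : ι → ℝ) : ℝ :=
  B (centredMonomial x I) (centredMonomial x J) x

theorem symb₁_sub (D E : Hom1 ι) (I : Multiset ι) (x : ι → ℝ) :
    symb₁ (D - E) I x = symb₁ D I x - symb₁ E I x := rfl

theorem symb₂_add (B C : Hom2 ι) (I J : Multiset ι) (x : ι → ℝ) :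
    symb₂ (B + C) I J x = symb₂ B I J x + symb₂ C I J x := rfl

theorem symb₂_sub (B C : Hom2 ι) (I J : Multiset ι) (x : ι → ℝ) :
    symb₂ (B - C) I J x = symb₂ B I J x - symb₂ C I J x := rfl

variable [DecidableEq ι]

theorem centredMonomial_self (x : ι → ℝ) (I : Multiset ι) :
    centredMonomial x I x = if I = 0 then 1 else 0 := by
  induction I using Multiset.induction_on with
  | empty => rw [centredMonomial_zero, if_pos rfl]; rfl
  | cons _ _ _ =>
    rw [centredMonomial_cons, Smooth.mul_apply, centredCoord_apply, sub_self, zero_mul,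
      if_neg (Multiset.cons_ne_zero)]

theorem pd_one (i : ι) : pd i (1 : Smooth ι) = 0 := Derivation.map_one_eq_zero _

theorem pd_centredCoord (x : ι → ℝ) (i j : ι) :
    pd i (centredCoord x j) = if i = j then 1 else 0 := by
  refine Smooth.ext fun y => ?_
  have h : HasFDerivAt (centredCoord x j : (ι → ℝ) → ℝ)
      (ContinuousLinearMap.proj (R := ℝ) (φ := fun _ : ι => ℝ) j) y :=
    (ContinuousLinearMap.hasFDerivAt
      (ContinuousLinearMap.proj (R := ℝ) (φ := fun _ : ι => ℝ) j)).sub_const (x j)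
  rw [pd_apply, h.fderiv, ContinuousLinearMap.proj_apply]
  by_cases hij : i = j
  · subst hij; rw [if_pos rfl, Pi.single_eq_same]; rfl
  · rw [if_neg hij, Pi.single_eq_of_ne (Ne.symm hij)]; rfl

theorem pd_centredMonomial (x : ι → ℝ) (i : ι) (I : Multiset ι) :
    pd i (centredMonomial x I) = I.count i • centredMonomial x (I.erase i) := by
  induction I using Multiset.induction_on with
  | empty => rw [centredMonomial_zero, pd_one]; simp
  | cons j I ih =>
    rw [centredMonomial_cons, Derivation.leibniz, ih, pd_centredCoord]
    by_cases hij : i = j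
    · subst hij
      rw [if_pos rfl, Multiset.count_cons_self, Multiset.erase_cons_head]
      by_cases hi : i ∈ I
      · rw [smul_eq_mul, mul_smul_comm, ← centredMonomial_cons, Multiset.cons_erase hi]
        simp only [smul_eq_mul, mul_one, add_smul, one_smul]
      · rw [Multiset.count_eq_zero_of_notMem hi]; simp
    · rw [if_neg hij, Multiset.count_cons_of_ne hij,
        Multiset.erase_cons_tail _ (fun h => hij h.symm), centredMonomial_cons]
      simp only [smul_eq_mul, mul_zero, add_zero, mul_smul_comm]

theorem pds_pd (i : ι) (I : Multiset ι) (f : Smooth ι) : pds I (pd i f) = pd i (pds I f) := by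
  induction I using Multiset.induction_on with
  | empty => rfl
  | cons j I ih => rw [pds_cons, pds_cons, ih, pd_comm]

/-- The factorial `I! = ∏_i I_i!` of a multi-index. -/
def multiFactorial (I : Multiset ι) : ℝ := ∏ i, ((I.count i).factorial : ℝ)

theorem multiFactorial_ne_zero (I : Multiset ι) : multiFactorial I ≠ 0 :=
  Finset.prod_ne_zero_iff.2 fun _ _ => Nat.cast_ne_zero.2 (Nat.factorial_ne_zero _)

theorem multiFactorial_cons (i : ι) (I : Multiset ι) :
    multiFactorial (i ::ₘ I) = ((I.count i + 1 : ℕ) : ℝ) * multiFactorial I := by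
  rw [multiFactorial, multiFactorial, ← Finset.mul_prod_erase _ _ (Finset.mem_univ i),
    ← Finset.mul_prod_erase Finset.univ (fun j => ((I.count j).factorial : ℝ))
      (Finset.mem_univ i), Multiset.count_cons_self, Nat.factorial_succ, Nat.cast_mul, mul_assoc]
  congr 2
  refine Finset.prod_congr rfl fun j hj => ?_
  rw [Multiset.count_cons_of_ne (Finset.ne_of_mem_erase hj)]

/-- Iterated derivatives and centred monomials are dual to each other up to factorials. This is what
makes symbols read off coefficients. -/
theorem pds_centredMonomial_self (x : ι → ℝ) (K I : Multiset ι) :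
    pds K (centredMonomial x I) x = if K = I then multiFactorial I else 0 := by
  induction K using Multiset.induction_on generalizing I with
  | empty =>
    rw [pds_zero, centredMonomial_self]
    by_cases h : I = 0
    · subst h; simp [multiFactorial]
    · rw [if_neg h, if_neg (Ne.symm h)]
  | cons i K ih =>
    rw [pds_cons, ← pds_pd, pd_centredMonomial, map_nsmul, ← Smooth.eval_apply, map_nsmul,
      Smooth.eval_apply, ih]
    by_cases hi : i ∈ I
    · obtain ⟨J, rfl⟩ := Multiset.exists_cons_of_mem hi
      rw [Multiset.erase_cons_head, Multiset.count_cons_self, multiFactorial_cons]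
      simp only [Multiset.cons_inj_right, nsmul_eq_mul, mul_ite, mul_zero]
    · rw [Multiset.count_eq_zero_of_notMem hi, zero_smul, if_neg]
      rintro rfl
      exact hi (Multiset.mem_cons_self _ _)

theorem mem_C1diff_iff {D : Hom1 ι} :
    D ∈ C1diff ι ↔ ∃ a : Multiset ι →₀ Smooth ι, D = a.sum fun I c => c • pds I := by
  rw [C1diff, Finsupp.mem_span_range_iff_exists_finsupp]
  exact exists_congr fun a => eq_comm

theorem mem_C2diff_iff {B : Hom2 ι} :
    B ∈ C2diff ι ↔ ∃ b : Multiset ι × Multiset ι →₀ Smooth ι,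
      B = b.sum fun p c => c • cup (pds p.1) (pds p.2) := by
  rw [C2diff, Finsupp.mem_span_range_iff_exists_finsupp]
  exact exists_congr fun a => eq_comm

theorem sum_smul_pds_apply (s : Finset (Multiset ι)) (a : Multiset ι → Smooth ι) (f : Smooth ι) :
    (∑ I ∈ s, a I • pds I) f = ∑ I ∈ s, a I * pds I f := by
  simp [LinearMap.sum_apply]

theorem symb₁_sum (s : Finset (Multiset ι)) (a : Multiset ι → Smooth ι)
    (hs : ∀ I ∉ s, a I = 0) (I : Multiset ι) (x : ι → ℝ) :
    symb₁ (∑ I ∈ s, a I • pds I) I x = multiFactorial I * a I x := by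
  rw [symb₁, sum_smul_pds_apply, Smooth.sum_apply]
  simp only [Smooth.mul_apply, pds_centredMonomial_self, mul_ite, mul_zero]
  rw [Finset.sum_ite_eq' s I]
  split_ifs with h
  · exact mul_comm _ _
  · rw [hs I h, Smooth.zero_apply, mul_zero]

theorem symb₂_sum (b : Multiset ι × Multiset ι →₀ Smooth ι) (I J : Multiset ι) (x : ι → ℝ) :
    symb₂ (b.sum fun p c => c • cup (pds p.1) (pds p.2)) I J x =
      multiFactorial I * multiFactorial J * b (I, J) x := by
  have h : ∀ f g, (b.sum fun p c => c • cup (pds p.1) (pds p.2)) f g =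
      ∑ p ∈ b.support, b p * (pds p.1 f * pds p.2 g) := by
    intro f g
    simp [Finsupp.sum, LinearMap.sum_apply, cup_apply]
  rw [symb₂, h, Smooth.sum_apply, Finset.sum_eq_single (I, J)]
  · simp only [Smooth.mul_apply, pds_centredMonomial_self, if_true]
    ring
  · rintro ⟨K, L⟩ - hne
    simp only [Smooth.mul_apply, pds_centredMonomial_self]
    by_cases hK : K = I
    · by_cases hL : L = J
      · exact absurd (by rw [hK, hL]) hne
      · rw [if_neg hL, mul_zero, mul_zero]
    · rw [if_neg hK, zero_mul, mul_zero]
  · intro h0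
    rw [Finsupp.notMem_support_iff.1 h0, zero_mul, Smooth.zero_apply]

/-- A bidifferential operator is determined by its symbol. -/
theorem C2diff_eq_zero {B : Hom2 ι} (hB : B ∈ C2diff ι) (h : ∀ I J x, symb₂ B I J x = 0) :
    B = 0 := by
  obtain ⟨b, rfl⟩ := mem_C2diff_iff.1 hB
  have : b = 0 := by
    refine Finsupp.ext fun p => Smooth.ext fun x => ?_
    have := h p.1 p.2 x
    rw [symb₂_sum] at this
    exact (mul_eq_zero.1 this).resolve_left
      (mul_ne_zero (multiFactorial_ne_zero _) (multiFactorial_ne_zero _))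
  rw [this, Finsupp.sum_zero_index]

/-- The symbol is smooth in the base point and finitely supported, and the operator can be rebuilt
from it. Pointwise statements about the symbol on the submanifold thereby become statements about
the operator. -/
theorem exists_symb₁ {D : Hom1 ι} (hD : D ∈ C1diff ι) :
    ∃ a : Multiset ι →₀ Smooth ι, (∀ I x, symb₁ D I x = a I x) ∧
      ∀ f, D f = ∑ I ∈ a.support, (multiFactorial I)⁻¹ • (a I * pds I f) := by
  obtain ⟨a, rfl⟩ := mem_C1diff_iff.1 hD
  refine ⟨Finsupp.onFinset a.support (fun I => multiFactorial I • a I) fun I h => ?_, ?_, ?_⟩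
  · rw [Finsupp.mem_support_iff]
    rintro h0
    exact h (by rw [h0, smul_zero])
  · intro I x
    rw [Finsupp.sum, symb₁_sum _ _ fun I => Finsupp.notMem_support_iff.1]
    rfl
  · intro f
    rw [Finsupp.sum, sum_smul_pds_apply]
    symm
    refine Finset.sum_subset_zero_on_sdiff Finsupp.support_onFinset_subset (fun I hI => ?_)
      fun I hI => ?_
    · have h0 := (Finset.mem_sdiff.1 hI).2
      rw [Finsupp.notMem_support_iff, Finsupp.onFinset_apply,
        smul_eq_zero_iff_right (multiFactorial_ne_zero I)] at h0
      rw [h0, zero_mul]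
    · rw [Finsupp.onFinset_apply, smul_mul_assoc, smul_smul,
        inv_mul_cancel₀ (multiFactorial_ne_zero I), one_smul]

theorem exists_symb₂ {B : Hom2 ι} (hB : B ∈ C2diff ι) :
    ∃ b : Multiset ι × Multiset ι →₀ Smooth ι, ∀ I J x, symb₂ B I J x = b (I, J) x := by
  obtain ⟨b, rfl⟩ := mem_C2diff_iff.1 hB
  refine ⟨Finsupp.onFinset b.support
    (fun p => (multiFactorial p.1 * multiFactorial p.2) • b p) fun p h => ?_, ?_⟩
  · rw [Finsupp.mem_support_iff]
    rintro h0
    exact h (by rw [h0, smul_zero])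
  · intro I J x
    rw [symb₂_sum]
    rfl

/-- Every finitely supported family of smooth functions is the symbol of a differential operator. -/
theorem exists_C1diff_symb₁ (a : Multiset ι →₀ Smooth ι) :
    ∃ D ∈ C1diff ι, ∀ I x, symb₁ D I x = a I x := by
  refine ⟨∑ I ∈ a.support, ((multiFactorial I)⁻¹ • a I) • pds I,
    sum_mem fun I _ => Submodule.smul_mem _ _ (Submodule.subset_span ⟨I, rfl⟩), fun I x => ?_⟩
  rw [symb₁_sum _ (fun I => (multiFactorial I)⁻¹ • a I) fun I h => ?_, Smooth.smul_apply,
    mul_inv_cancel_left₀ (multiFactorial_ne_zero I)]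
  rw [Finsupp.notMem_support_iff.1 h, smul_zero]

/-! ### Symbols of coboundaries, cocycles and `U X` -/

theorem symb₂_δ₁ (D : Hom1 ι) (I J : Multiset ι) (x : ι → ℝ) :
    symb₂ (δ₁ D) I J x = (if I = 0 then 1 else 0) * symb₁ D J x - symb₁ D (I + J) x +
      symb₁ D I x * (if J = 0 then 1 else 0) := by
  rw [symb₂, δ₁_apply, ← centredMonomial_add, Smooth.add_apply, Smooth.sub_apply,
    Smooth.mul_apply, Smooth.mul_apply, centredMonomial_self, centredMonomial_self]
  rfl

theorem symb₂_δ₁_of_ne {D : Hom1 ι} {I J : Multiset ι} (hI : I ≠ 0) (hJ : J ≠ 0) (x : ι → ℝ) :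
    symb₂ (δ₁ D) I J x = -symb₁ D (I + J) x := by
  rw [symb₂_δ₁, if_neg hI, if_neg hJ]; ring

theorem symb₂_cocycle {B : Hom2 ι} (hB : δ₂ B = 0) (I J K : Multiset ι) (x : ι → ℝ) :
    (if I = 0 then 1 else 0) * symb₂ B J K x - symb₂ B (I + J) K x + symb₂ B I (J + K) x -
      symb₂ B I J x * (if K = 0 then 1 else 0) = 0 := by
  have h : δ₂ B (centredMonomial x I) (centredMonomial x J) (centredMonomial x K) x = 0 := by
    rw [hB]; rfl
  rw [δ₂_apply, ← centredMonomial_add, ← centredMonomial_add, Smooth.sub_apply, Smooth.add_apply,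
    Smooth.sub_apply, Smooth.mul_apply, Smooth.mul_apply, centredMonomial_self,
    centredMonomial_self] at h
  exact h

/-- The two outer terms of the Hochschild differential carry a factor `(y - x)^I` or `(y - x)^K`
evaluated at `x`, which vanishes. What remains is the moving rule required by `eq_of_add_eq` and
`eq_zero_of_card`. -/
theorem symb₂_cocycle_assoc {B : Hom2 ι} (hB : δ₂ B = 0) {I K : Multiset ι} (hI : I ≠ 0)
    (hK : K ≠ 0) (J : Multiset ι) (x : ι → ℝ) :
    symb₂ B (I + J) K x = symb₂ B I (J + K) x := by
  have := symb₂_cocycle hB I J K x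
  rw [if_neg hI, if_neg hK] at this
  linarith

theorem symb₂_cocycle_zero_left {B : Hom2 ι} (hB : δ₂ B = 0) {K : Multiset ι} (hK : K ≠ 0)
    (x : ι → ℝ) : symb₂ B 0 K x = 0 := by
  have := symb₂_cocycle hB 0 0 K x
  rw [if_neg hK, if_pos rfl, zero_add, zero_add] at this
  linarith

theorem symb₂_cocycle_zero_right {B : Hom2 ι} (hB : δ₂ B = 0) {K : Multiset ι} (hK : K ≠ 0)
    (x : ι → ℝ) : symb₂ B K 0 x = 0 := by
  have := symb₂_cocycle hB K 0 0 x
  rw [if_neg hK, if_pos rfl, add_zero, add_zero] at this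
  linarith

theorem pd_centredMonomial_self (x : ι → ℝ) (i : ι) (I : Multiset ι) :
    pd i (centredMonomial x I) x = if I = {i} then 1 else 0 := by
  have := pds_centredMonomial_self x {i} I
  rw [← Multiset.cons_zero, pds_cons, pds_zero, Multiset.cons_zero] at this
  rw [this]
  by_cases h : I = {i}
  · subst h
    rw [if_pos rfl, if_pos rfl, ← Multiset.cons_zero, multiFactorial_cons]
    simp [multiFactorial]
  · rw [if_neg h, if_neg (Ne.symm h)]

theorem symb₂_U_singleton (X : Bivec ι) (i j : ι) (x : ι → ℝ) :
    symb₂ (U X) {i} {j} x = (1 / 2) * X.1 i j x := by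
  rw [symb₂, U_apply, Smooth.smul_apply, Smooth.sum_apply, Finset.sum_eq_single i]
  · rw [Smooth.sum_apply, Finset.sum_eq_single j]
    · simp [Smooth.mul_apply, pd_centredMonomial_self]
    · intro k _ hk
      rw [Smooth.mul_apply, Smooth.mul_apply, pd_centredMonomial_self, pd_centredMonomial_self,
        if_neg (c := ({j} : Multiset ι) = {k}) (fun h => hk (Multiset.singleton_inj.1 h).symm)]
      ring
    · simp
  · intro k _ hk
    rw [Smooth.sum_apply]
    refine Finset.sum_eq_zero fun l _ => ?_
    rw [Smooth.mul_apply, Smooth.mul_apply, pd_centredMonomial_self,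
      if_neg (fun h => hk (Multiset.singleton_inj.1 h).symm)]
    ring
  · simp

theorem symb₂_U_of_card {X : Bivec ι} {I J : Multiset ι} (h : I.card ≠ 1 ∨ J.card ≠ 1)
    (x : ι → ℝ) : symb₂ (U X) I J x = 0 := by
  rw [symb₂, U_apply, Smooth.smul_apply, Smooth.sum_apply, Finset.sum_eq_zero, mul_zero]
  intro k _
  rw [Smooth.sum_apply]
  refine Finset.sum_eq_zero fun l _ => ?_
  rw [Smooth.mul_apply, Smooth.mul_apply, pd_centredMonomial_self, pd_centredMonomial_self]
  rcases h with h | h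
  · rw [if_neg (fun h' => h (by rw [h', Multiset.card_singleton]))]; ring
  · rw [if_neg (c := J = {l}) (fun h' => h (by rw [h', Multiset.card_singleton]))]; ring

/-! ### The classical HKR theorem in degree two -/

/-- The bivector field `X^{ij} = B^{ij} - B^{ji}` of a differential `2`-cocycle `B`, together with a
differential operator whose coboundary is `B - U(X)`. -/
theorem exists_U_add_δ₁ {B : Hom2 ι} (hB : B ∈ Z2 ι) :
    ∃ X : Bivec ι, ∃ D ∈ C1diff ι, B = U X + δ₁ D ∧ ∀ i x, symb₁ D {i} x = 0 := by
  obtain ⟨hB2, hB0⟩ := hB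
  replace hB0 : δ₂ B = 0 := hB0
  obtain ⟨b, hb⟩ := exists_symb₂ hB2
  let s : Multiset ι × Multiset ι → Smooth ι := fun p => (1 / 2 : ℝ) • (b p + b (p.2, p.1))
  let P : Multiset ι → Prop := fun M => ∃ p : Multiset ι × Multiset ι,
    p.1 ≠ 0 ∧ p.2 ≠ 0 ∧ p.1 + p.2 = M
  classical
  -- This is the intended symbol of `D`. By `symb₂_δ₁_of_ne` its value on `I + J` must be minus the
  -- symmetrised symbol at `(I, J)`, so any splitting may be chosen. At `M = 0` the coboundary
  -- reproduces the value itself, whence `b (0, 0)`. Singletons do not split, and the value `0`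
  -- there normalizes `D`, since first-order terms have zero coboundary.
  let d : Multiset ι → Smooth ι := fun M =>
    if h : P M then -s h.choose else if M = 0 then b (0, 0) else 0
  have hs : ∀ p x, s p x = 1 / 2 * (symb₂ B p.1 p.2 x + symb₂ B p.2 p.1 x) := fun p x => by
    rw [hb, hb]; rfl
  have hd : ∀ I J, I ≠ 0 → J ≠ 0 → ∀ x, d (I + J) x = -s (I, J) x := by
    intro I J hI hJ x
    have h : P (I + J) := ⟨(I, J), hI, hJ, rfl⟩
    obtain ⟨h1, h2, h3⟩ := h.choose_spec
    have : d (I + J) = -s h.choose := dif_pos h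
    rw [this, Smooth.neg_apply, hs, hs]
    refine congrArg Neg.neg (eq_of_add_eq
      (s := fun I J => 1 / 2 * (symb₂ B I J x + symb₂ B J I x)) (fun I J => ?_)
      (fun I J K hI hK => ?_) h1 h2 hI hJ h3)
    · rw [add_comm]
    · rw [symb₂_cocycle_assoc hB0 hI hK, add_comm I J, add_comm J K,
        symb₂_cocycle_assoc hB0 hK hI]
  -- If `d M` is nonzero, then the chosen splitting or its swap lies in the finite support of `b`;
  -- for `M = 0` the pair `(0, 0)` does.
  have hsupp : ∀ M, d M ≠ 0 → M ∈ b.support.image fun p => p.1 + p.2 := by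
    intro M hM
    rw [Finset.mem_image]
    by_cases h : P M
    · obtain ⟨h1, h2, h3⟩ := h.choose_spec
      have hM' : d M = -s h.choose := dif_pos h
      rw [hM'] at hM
      by_cases hp : b h.choose = 0
      · refine ⟨(h.choose.2, h.choose.1), Finsupp.mem_support_iff.2 fun h0 => hM ?_, ?_⟩
        · change -((1 / 2 : ℝ) • (b h.choose + b (h.choose.2, h.choose.1))) = 0
          rw [hp, h0, add_zero, smul_zero, neg_zero]
        · rw [add_comm]; exact h3
      · exact ⟨_, Finsupp.mem_support_iff.2 hp, h3⟩
    · have hM' : d M = if M = 0 then b (0, 0) else 0 := dif_neg h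
      rw [hM'] at hM
      by_cases h0 : M = 0
      · rw [if_pos h0] at hM
        exact ⟨(0, 0), Finsupp.mem_support_iff.2 hM, by rw [h0, add_zero]⟩
      · rw [if_neg h0] at hM
        exact absurd rfl hM
  obtain ⟨D, hD, hDd⟩ := exists_C1diff_symb₁ (Finsupp.onFinset _ d hsupp)
  replace hDd : ∀ I x, symb₁ D I x = d I x := hDd
  -- The factor `1/2` of the antisymmetrisation is already contained in `U`.
  let X : Bivec ι := ⟨fun i j => b ({i}, {j}) - b ({j}, {i}), fun i j => by ring⟩
  have hX : ∀ i j x, X.1 i j x = symb₂ B {i} {j} x - symb₂ B {j} {i} x := fun i j x => by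
    rw [hb, hb]; rfl
  refine ⟨X, D, hD, ?_, fun i x => ?_⟩
  · refine sub_eq_zero.1 (C2diff_eq_zero (sub_mem hB2 (add_mem (U_mem_C2diff X) (δ₁_mem hD)))
      fun I J x => ?_)
    rw [symb₂_sub, symb₂_add]
    by_cases hI : I = 0
    · subst hI
      rw [symb₂_U_of_card (Or.inl (by simp)), symb₂_δ₁, if_pos rfl, zero_add, zero_add]
      by_cases hJ : J = 0
      · subst hJ
        have : d 0 = b (0, 0) := by
          refine (dif_neg ?_).trans (if_pos rfl)
          rintro ⟨p, h1, -, h3⟩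
          exact h1 (add_eq_zero.1 h3).1
        rw [if_pos rfl, hDd, this, hb]
        ring
      · rw [if_neg hJ, symb₂_cocycle_zero_left hB0 hJ]
        ring
    by_cases hJ : J = 0
    · subst hJ
      rw [symb₂_U_of_card (Or.inr (by simp)), symb₂_δ₁, if_pos rfl, if_neg hI, add_zero,
        symb₂_cocycle_zero_right hB0 hI]
      ring
    rw [symb₂_δ₁_of_ne hI hJ, hDd, hd I J hI hJ, hs]
    -- `δ₁ D` accounts for the symmetric part of the symbol. The antisymmetric part vanishes by
    -- `eq_zero_of_card`, except on pairs of singletons, where it is the symbol of `U X`.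
    by_cases h : I.card ≠ 1 ∨ J.card ≠ 1
    · rw [symb₂_U_of_card h]
      have := eq_zero_of_card (a := fun I J => symb₂ B I J x - symb₂ B J I x) (fun I J => by ring)
        (fun I J K hI hK => by
          rw [symb₂_cocycle_assoc hB0 hI hK, add_comm I J, add_comm J K,
            symb₂_cocycle_assoc hB0 hK hI]) hI hJ h
      linarith
    · push Not at h
      obtain ⟨i, rfl⟩ := Multiset.card_eq_one.1 h.1
      obtain ⟨j, rfl⟩ := Multiset.card_eq_one.1 h.2
      rw [symb₂_U_singleton, hX]
      ring
  · rw [hDd]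
    have : d {i} = 0 := by
      refine (dif_neg ?_).trans (if_neg (Multiset.singleton_ne_zero i))
      rintro ⟨p, h1, h2, h3⟩
      have := congrArg Multiset.card h3
      rw [Multiset.card_add, Multiset.card_singleton] at this
      have := Multiset.card_pos.2 h1
      have := Multiset.card_pos.2 h2
      omega
    rw [this, Smooth.zero_apply]

/-- The bivector field is recovered from the antisymmetric part of the symbol. -/
theorem bivec_apply_of_U_add_δ₁ {X : Bivec ι} {D : Hom1 ι} (i j : ι) (x : ι → ℝ) :
    X.1 i j x = symb₂ (U X + δ₁ D) {i} {j} x - symb₂ (U X + δ₁ D) {j} {i} x := by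
  have hi := Multiset.singleton_ne_zero i
  have hj := Multiset.singleton_ne_zero j
  -- The coboundary contributes `-symb₁ D ({i} + {j}) x` in both orders and cancels in the
  -- difference.
  rw [symb₂_add, symb₂_add, symb₂_U_singleton, symb₂_U_singleton, symb₂_δ₁_of_ne hi hj,
    symb₂_δ₁_of_ne hj hi, add_comm ({j} : Multiset ι), X.2 j i, Smooth.neg_apply]
  ring

theorem bivec_eq_zero_of_U_eq_δ₁ {X : Bivec ι} {D : Hom1 ι} (h : U X + δ₁ D = 0) : X = 0 := by
  refine Subtype.ext (funext fun i => funext fun j => Smooth.ext fun x => ?_)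
  rw [bivec_apply_of_U_add_δ₁ (D := D), h]
  exact sub_self _

variable (ι) in
/-- The Hochschild–Kostant–Rosenberg theorem in degree two. -/
theorem UHH_bijective : Function.Bijective (UHH ι) := by
  constructor
  · refine (injective_iff_map_eq_zero _).2 fun X hX => ?_
    obtain ⟨D, -, hD⟩ := (Submodule.Quotient.mk_eq_zero _).1 hX
    replace hD : δ₁ D = U X := hD
    refine bivec_eq_zero_of_U_eq_δ₁ (D := -D) ?_
    rw [map_neg, hD, add_neg_cancel]
  · rintro ⟨B⟩
    obtain ⟨X, D, hD, hB, -⟩ := exists_U_add_δ₁ B.2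
    refine ⟨X, (Submodule.Quotient.eq _).2 ⟨-D, neg_mem hD, ?_⟩⟩
    change δ₁ (-D) = U X - B.1
    rw [hB, map_neg]
    abel

end Symbols

/-! ### Transport along a coordinate inclusion: pullback, restriction, induced cochains -/

section ExtendByZero

variable {κ ι : Type} [Fintype κ] [Fintype ι]

/-- Pullback of smooth functions along the inclusion `ℝ^κ → ℝ^ι` which extends by zero. -/
def Smooth.restr (e : κ → ι) : Smooth ι →ₗ[ℝ] Smooth κ where
  toFun f := Smooth.mk (fun y => f (Function.extend e y 0))
    (f.contDiff.comp (LinearMap.toContinuousLinearMap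
      (Function.ExtendByZero.linearMap ℝ e)).contDiff)
  map_add' _ _ := rfl
  map_smul' _ _ := rfl

theorem Smooth.restr_apply (e : κ → ι) (f : Smooth ι) (y : κ → ℝ) :
    Smooth.restr e f y = f (Function.extend e y 0) := rfl

theorem Smooth.restr_mul (e : κ → ι) (f g : Smooth ι) :
    Smooth.restr e (f * g) = Smooth.restr e f * Smooth.restr e g := rfl

theorem Smooth.pull_apply (e : κ → ι) (a : Smooth κ) (x : ι → ℝ) :
    Smooth.pull e a x = a (fun k => x (e k)) := rfl

variable {e : κ → ι}

theorem Smooth.restr_pull (he : Function.Injective e) (a : Smooth κ) :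
    Smooth.restr e (Smooth.pull e a) = a := by
  refine Smooth.ext fun y => ?_
  rw [Smooth.restr_apply, Smooth.pull_apply]
  exact congrArg a (funext fun k => he.extend_apply y 0 k)

/-- The `1`-cochain on `ℝ^κ` induced from a `1`-cochain on `ℝ^ι` by extending functions constantly
and restricting the result. -/
def Hom1.reduce (e : κ → ι) (D : Hom1 ι) : Hom1 κ := Smooth.restr e ∘ₗ D ∘ₗ Smooth.pull e

/-- The `2`-cochain on `ℝ^κ` induced from a `2`-cochain on `ℝ^ι` by extending functions constantly
and restricting the result. -/
def Hom2.reduce (e : κ → ι) : Hom2 ι →ₗ[ℝ] Hom2 κ where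
  toFun B := (B.compl₁₂ (Smooth.pull e) (Smooth.pull e)).compr₂ (Smooth.restr e)
  map_add' _ _ := rfl
  map_smul' _ _ := rfl

theorem Hom1.reduce_apply (D : Hom1 ι) (a : Smooth κ) :
    Hom1.reduce e D a = Smooth.restr e (D (Smooth.pull e a)) := rfl

theorem Hom2.reduce_apply (B : Hom2 ι) (a b : Smooth κ) :
    Hom2.reduce e B a b = Smooth.restr e (B (Smooth.pull e a) (Smooth.pull e b)) := rfl

/-- Pullback and restriction are both multiplicative, and restriction is a left inverse of pullback;
hence every term of the Hochschild differential is respected. -/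
theorem Hom2.reduce_δ₁ (he : Function.Injective e) (D : Hom1 ι) :
    Hom2.reduce e (δ₁ D) = δ₁ (Hom1.reduce e D) := by
  refine LinearMap.ext₂ fun a b => ?_
  rw [Hom2.reduce_apply, δ₁_apply, δ₁_apply, map_add, map_sub, Smooth.restr_mul,
    Smooth.restr_mul, Smooth.restr_pull he, Smooth.restr_pull he]
  rfl

theorem Hom2.reduce_cocycle (he : Function.Injective e) {B : Hom2 ι} (hB : δ₂ B = 0) :
    δ₂ (Hom2.reduce e B) = 0 := by
  funext a b c
  have h : Smooth.restr e (δ₂ B (Smooth.pull e a) (Smooth.pull e b) (Smooth.pull e c)) = 0 := by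
    rw [hB]; rfl
  rw [δ₂_apply, map_sub, map_add, map_sub, Smooth.restr_mul, Smooth.restr_mul,
    Smooth.restr_pull he, Smooth.restr_pull he] at h
  exact h

/-- The bivector field on `ℝ^κ` with the restricted coefficients. -/
def Bivec.reduce (e : κ → ι) : Bivec ι →ₗ[ℝ] Bivec κ where
  toFun X := ⟨fun k l => Smooth.restr e (X.1 (e k) (e l)), fun k l => by
    beta_reduce
    rw [X.2, map_neg]⟩
  map_add' _ _ := rfl
  map_smul' _ _ := rfl

theorem Bivec.reduce_apply (X : Bivec ι) (k l : κ) :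
    (Bivec.reduce e X).1 k l = Smooth.restr e (X.1 (e k) (e l)) := rfl

variable [DecidableEq ι]

theorem pd_pull_apply (i : ι) (a : Smooth κ) (x : ι → ℝ) :
    pd i (Smooth.pull e a) x =
      fderiv ℝ a (fun k => x (e k)) (fun k => (Pi.single i 1 : ι → ℝ) (e k)) := by
  let L : (ι → ℝ) →L[ℝ] (κ → ℝ) :=
    ContinuousLinearMap.pi fun k => ContinuousLinearMap.proj (e k)
  have h : HasFDerivAt (fun y => a (L y)) ((fderiv ℝ a (L x)).comp L) x :=
    (a.diff (L x)).hasFDerivAt.comp x L.hasFDerivAt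
  rw [pd_apply]
  exact congrArg (fun M : (ι → ℝ) →L[ℝ] ℝ => M (Pi.single i 1)) h.fderiv

theorem pd_pull [DecidableEq κ] (he : Function.Injective e) (k : κ) (a : Smooth κ) :
    pd (e k) (Smooth.pull e a) = Smooth.pull e (pd k a) := by
  refine Smooth.ext fun x => ?_
  rw [pd_pull_apply, Smooth.pull_apply, pd_apply]
  congr 1
  funext l
  by_cases h : l = k
  · subst h; simp
  · rw [Pi.single_eq_of_ne h, Pi.single_eq_of_ne (fun h' => h (he h'))]

theorem pd_pull_of_notMem_range {i : ι} (hi : i ∉ Set.range e) (a : Smooth κ) :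
    pd i (Smooth.pull e a) = 0 := by
  refine Smooth.ext fun x => ?_
  have : (fun k => (Pi.single i 1 : ι → ℝ) (e k)) = 0 :=
    funext fun k => Pi.single_eq_of_ne (fun h => hi ⟨k, h⟩) _
  rw [pd_pull_apply, this, map_zero, Smooth.zero_apply]

variable [DecidableEq κ]

theorem pds_map_pull (he : Function.Injective e) (I : Multiset κ) (a : Smooth κ) :
    pds (I.map e) (Smooth.pull e a) = Smooth.pull e (pds I a) := by
  induction I using Multiset.induction_on with
  | empty => rfl
  | cons k I ih => rw [Multiset.map_cons, pds_cons, ih, pd_pull he, pds_cons]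

/-- A single direction outside the range of `e` kills pulled-back functions; otherwise all
directions come from `κ`. Hence induced cochains are again differential operators. -/
theorem pds_pull (he : Function.Injective e) (I : Multiset ι) :
    (∀ a, pds I (Smooth.pull e a) = 0) ∨ ∃ K : Multiset κ, I = K.map e := by
  induction I using Multiset.induction_on with
  | empty => exact Or.inr ⟨0, rfl⟩
  | cons i I ih =>
    rcases ih with h | ⟨K, rfl⟩
    · exact Or.inl fun a => by rw [pds_cons, h, map_zero]
    · by_cases hi : i ∈ Set.range e
      · obtain ⟨k, rfl⟩ := hi
        exact Or.inr ⟨k ::ₘ K, by rw [Multiset.map_cons]⟩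
      · exact Or.inl fun a => by rw [pds_cons, pds_map_pull he, pd_pull_of_notMem_range hi]

theorem Hom1.reduce_mem (he : Function.Injective e) {D : Hom1 ι} (hD : D ∈ C1diff ι) :
    Hom1.reduce e D ∈ C1diff κ := by
  induction hD using Submodule.span_induction with
  | mem D hD =>
    obtain ⟨I, rfl⟩ := hD
    rcases pds_pull he I with h | ⟨K, rfl⟩
    · have : Hom1.reduce e (pds I) = 0 := LinearMap.ext fun a => by
        rw [Hom1.reduce_apply, h, map_zero, LinearMap.zero_apply]
      rw [this]; exact zero_mem _
    · have : Hom1.reduce e (pds (K.map e)) = pds K := LinearMap.ext fun a => by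
        rw [Hom1.reduce_apply, pds_map_pull he, Smooth.restr_pull he]
      rw [this]; exact Submodule.subset_span ⟨K, rfl⟩
  | zero => exact zero_mem _
  | add D E _ _ h h' => exact add_mem h h'
  | smul c D _ h => exact Submodule.smul_mem _ (Smooth.restr e c) h

theorem Hom2.reduce_mem (he : Function.Injective e) {B : Hom2 ι} (hB : B ∈ C2diff ι) :
    Hom2.reduce e B ∈ C2diff κ := by
  induction hB using Submodule.span_induction with
  | mem B hB =>
    obtain ⟨⟨I, J⟩, rfl⟩ := hB
    rcases pds_pull he I with h | ⟨K, rfl⟩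
    · have : Hom2.reduce e (cup (pds I) (pds J)) = 0 := LinearMap.ext₂ fun a b => by
        rw [Hom2.reduce_apply, cup_apply, h, zero_mul, map_zero]; rfl
      rw [this]; exact zero_mem _
    rcases pds_pull he J with h | ⟨L, rfl⟩
    · have : Hom2.reduce e (cup (pds (K.map e)) (pds J)) = 0 := LinearMap.ext₂ fun a b => by
        rw [Hom2.reduce_apply, cup_apply, h, mul_zero, map_zero]; rfl
      rw [this]; exact zero_mem _
    · have : Hom2.reduce e (cup (pds (K.map e)) (pds (L.map e))) = cup (pds K) (pds L) :=
        LinearMap.ext₂ fun a b => by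
          rw [Hom2.reduce_apply, cup_apply, pds_map_pull he, pds_map_pull he, Smooth.restr_mul,
            Smooth.restr_pull he, Smooth.restr_pull he, cup_apply]
      rw [this]; exact Submodule.subset_span ⟨(K, L), rfl⟩
  | zero => exact zero_mem _
  | add D E _ _ h h' => exact add_mem h h'
  | smul c D _ h => exact Submodule.smul_mem _ (Smooth.restr e c) h

theorem Hom2.reduce_mem_Z2 (he : Function.Injective e) {B : Hom2 ι} (hB : B ∈ Z2 ι) :
    Hom2.reduce e B ∈ Z2 κ :=
  ⟨Hom2.reduce_mem he hB.1, Hom2.reduce_cocycle he hB.2⟩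

theorem Hom2.reduce_U (he : Function.Injective e) (X : Bivec ι) :
    Hom2.reduce e (U X) = U (Bivec.reduce e X) := by
  refine LinearMap.ext₂ fun a b => ?_
  rw [Hom2.reduce_apply, U_apply, U_apply, map_smul, map_sum]
  congr 1
  symm
  refine Fintype.sum_of_injective e he _ _ (fun i hi => ?_) fun k => ?_
  · rw [Finset.sum_eq_zero, map_zero]
    intro j _
    rw [pd_pull_of_notMem_range hi, zero_mul, mul_zero]
  · rw [map_sum]
    refine Fintype.sum_of_injective e he _ _ (fun j hj => ?_) fun l => ?_
    · rw [pd_pull_of_notMem_range hj, mul_zero, mul_zero, map_zero]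
    · rw [pd_pull he, pd_pull he, Smooth.restr_mul, Smooth.restr_mul, Smooth.restr_pull he,
        Smooth.restr_pull he, Bivec.reduce_apply]

end ExtendByZero

section Constraint

variable {n : ConDim}

/-! ### Functions which are constant along the distribution -/

theorem ConDim.idx_injective : Function.Injective n.idx := fun i j h => by
  have := congrArg Fin.val h
  simp only [ConDim.idx] at this
  exact Fin.ext (by omega)

theorem ConDim.le_idx (j : Fin n.red) : n.O ≤ n.idx j := Nat.le_add_right _ _

theorem ConDim.idx_lt (j : Fin n.red) : (n.idx j : ℕ) < n.N := by
  have := j.2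
  have := n.O_le_N
  simp only [ConDim.idx, ConDim.red] at *
  omega

theorem ConDim.exists_idx {i : Fin n.T} (h : n.O ≤ i) (h' : (i : ℕ) < n.N) :
    ∃ j : Fin n.red, n.idx j = i :=
  ⟨⟨i - n.O, by unfold ConDim.red; omega⟩, Fin.ext (by simp only [ConDim.idx]; omega)⟩

theorem ConDim.extend_mem_sub (y : Fin n.red → ℝ) : Function.extend n.idx y 0 ∈ n.sub := by
  intro i hi
  rw [Function.extend_apply']
  · rfl
  · rintro ⟨j, rfl⟩
    exact absurd (n.idx_lt j) (not_lt.2 hi)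

theorem ConDim.proj_extend (y : Fin n.red → ℝ) : n.proj (Function.extend n.idx y 0) = y :=
  funext fun j => n.idx_injective.extend_apply y 0 j

theorem ConDim.extend_castLE {x : Fin n.T → ℝ} (hx : x ∈ n.sub) :
    Function.extend (Fin.castLE n.N_le_T) (fun k => x (Fin.castLE n.N_le_T k)) 0 = x := by
  funext i
  by_cases hi : (i : ℕ) < n.N
  · exact (Fin.castLE_injective n.N_le_T).extend_apply _ 0 (⟨i, hi⟩ : Fin n.N)
  · rw [Function.extend_apply', hx i (not_lt.1 hi)]
    · rfl
    · rintro ⟨j, rfl⟩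
      exact hi j.2

theorem ConDim.extend_castLE_mem_sub (y : Fin n.N → ℝ) :
    Function.extend (Fin.castLE n.N_le_T) y 0 ∈ n.sub := by
  intro i hi
  rw [Function.extend_apply']
  · rfl
  · rintro ⟨j, rfl⟩
    exact absurd j.2 (not_lt.2 hi)

theorem fderiv_eq_sum_pd (f : Smooth (Fin n.T)) (x v : Fin n.T → ℝ) :
    fderiv ℝ f x v = ∑ i, v i * pd i f x := by
  conv_lhs => rw [← Finset.univ_sum_single v]
  rw [map_sum]
  refine Finset.sum_congr rfl fun i _ => ?_
  rw [pd_apply, ← smul_eq_mul, ← map_smul, ← Pi.single_smul, smul_eq_mul, mul_one]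

/-- The fibres of the projection on the submanifold are affine. Two points of a fibre are joined by
a segment in it, along which the derivative of `f` only involves `∂_i` with `i < n.O`. -/
theorem mem_funN_iff {f : Smooth (Fin n.T)} :
    f ∈ funN n ↔ ∀ x ∈ n.sub, ∀ y ∈ n.sub, n.proj x = n.proj y → f x = f y := by
  constructor
  · intro hf x hx y hy hxy
    have hd : ∀ t : ℝ, HasDerivAt (fun t : ℝ => f (x + t • (y - x)))
        (fderiv ℝ f (x + t • (y - x)) (y - x)) t := fun t =>
      (f.diff _).hasFDerivAt.comp_hasDerivAt t (by
        simpa using ((hasDerivAt_id t).smul_const (y - x)).const_add x)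
    have h0 : ∀ t : ℝ, deriv (fun t : ℝ => f (x + t • (y - x))) t = 0 := fun t => by
      rw [(hd t).deriv, fderiv_eq_sum_pd]
      refine Finset.sum_eq_zero fun i _ => ?_
      by_cases hi : (i : ℕ) < n.O
      · rw [hf i hi _ fun j hj => by simp [hx j hj, hy j hj], mul_zero]
      · have : (y - x) i = 0 := by
          by_cases hi' : (i : ℕ) < n.N
          · obtain ⟨j, rfl⟩ := n.exists_idx (not_lt.1 hi) hi'
            exact sub_eq_zero.2 (congrFun hxy j).symm
          · rw [Pi.sub_apply, hx i (not_lt.1 hi'), hy i (not_lt.1 hi'), sub_zero]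
        rw [this, zero_mul]
    have := is_const_of_deriv_eq_zero (fun t => (hd t).differentiableAt) h0 0 1
    simpa using this
  · intro hf i hi x hx
    have hd : HasDerivAt (fun t : ℝ => f (x + t • (Pi.single i 1 : Fin n.T → ℝ)))
        (pd i f x) 0 := by
      have h1 : HasFDerivAt f (fderiv ℝ f x) (x + (0 : ℝ) • (Pi.single i 1 : Fin n.T → ℝ)) := by
        simpa using (f.diff x).hasFDerivAt
      exact h1.comp_hasDerivAt (0 : ℝ) (by
        simpa using ((hasDerivAt_id (0 : ℝ)).smul_const
          (Pi.single i 1 : Fin n.T → ℝ)).const_add x)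
    have hc : (fun t : ℝ => f (x + t • (Pi.single i 1 : Fin n.T → ℝ))) = fun _ => f x := by
      funext t
      refine hf _ (fun j hj => ?_) x hx (funext fun j => ?_)
      · have hji : j ≠ i := by
          rintro rfl
          have := n.O_le_N
          omega
        simp [hx j hj, Pi.single_eq_of_ne hji]
      · have hji : n.idx j ≠ i := by
          rintro rfl
          exact absurd hi (not_lt.2 (n.le_idx j))
        simp [ConDim.proj, Pi.single_eq_of_ne hji]
    rw [hc] at hd
    exact hd.unique (hasDerivAt_const _ _)

theorem pds_funO {I : Multiset (Fin n.T)} (hI : ∀ i ∈ I, (i : ℕ) < n.N) {f : Smooth (Fin n.T)}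
    (hf : f ∈ funO n) : pds I f ∈ funO n := by
  induction I using Multiset.induction_on with
  | empty => exact hf
  | cons i I ih =>
    rw [pds_cons]
    exact pd_funO (hI i (Multiset.mem_cons_self i I))
      (ih fun j hj => hI j (Multiset.mem_cons_of_mem hj))

theorem pds_funN {I : Multiset (Fin n.T)} (hI : ∀ i ∈ I, (i : ℕ) < n.N) {f : Smooth (Fin n.T)}
    (hf : f ∈ funN n) : pds I f ∈ funN n := by
  induction I using Multiset.induction_on with
  | empty => exact hf
  | cons i I ih =>
    rw [pds_cons]
    exact pd_funN (hI i (Multiset.mem_cons_self i I))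
      (ih fun j hj => hI j (Multiset.mem_cons_of_mem hj))

/-- Partial derivatives commute, so the one along the distribution can be applied first; the others
are tangential and preserve `funO n`. -/
theorem pds_funN_of_mem {I : Multiset (Fin n.T)} (hI : ∀ i ∈ I, (i : ℕ) < n.N) {i : Fin n.T}
    (hi : i ∈ I) (hiO : (i : ℕ) < n.O) {f : Smooth (Fin n.T)} (hf : f ∈ funN n) :
    pds I f ∈ funO n := by
  obtain ⟨J, rfl⟩ := Multiset.exists_cons_of_mem hi
  rw [pds_cons, ← pds_pd]
  exact pds_funO (fun j hj => hI j (Multiset.mem_cons_of_mem hj)) (hf i hiO)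

theorem one_funN : (1 : Smooth (Fin n.T)) ∈ funN n := fun i _ => by
  rw [pd_one]; exact zero_mem _

/-- Together with `centredMonomial_funO` this supplies the test functions that turn constraint
conditions on an operator into conditions on its symbol. -/
theorem centredMonomial_funN (x : Fin n.T → ℝ) {I : Multiset (Fin n.T)}
    (hI : ∀ i ∈ I, n.O ≤ i) : centredMonomial x I ∈ funN n := by
  induction I using Multiset.induction_on with
  | empty => rw [centredMonomial_zero]; exact one_funN
  | cons i I ih =>
    rw [centredMonomial_cons]
    refine mul_funN (fun j hj => ?_) (ih fun j hj => hI j (Multiset.mem_cons_of_mem hj))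
    rw [pd_centredCoord, if_neg]
    · exact zero_mem _
    · rintro rfl
      exact absurd hj (not_lt.2 (hI j (Multiset.mem_cons_self j I)))

theorem centredMonomial_funO {x : Fin n.T → ℝ} (hx : x ∈ n.sub) {I : Multiset (Fin n.T)}
    {i : Fin n.T} (hi : i ∈ I) (hiN : n.N ≤ i) : centredMonomial x I ∈ funO n := by
  obtain ⟨J, rfl⟩ := Multiset.exists_cons_of_mem hi
  rw [centredMonomial_cons]
  refine funO_mul _ fun y hy => ?_
  rw [centredCoord_apply, hx i hiN, hy i hiN, sub_zero]

/-- Symbols at two points of the same fibre thus become values of one and the same function, to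
which `mem_funN_iff` applies. -/
theorem centredMonomial_congr {x y : Fin n.T → ℝ} (hxy : n.proj x = n.proj y)
    {I : Multiset (Fin n.T)} (hI : ∀ i ∈ I, n.O ≤ i ∧ (i : ℕ) < n.N) :
    centredMonomial x I = centredMonomial y I := by
  refine congrArg Multiset.prod (Multiset.map_congr rfl fun i hi => ?_)
  obtain ⟨j, rfl⟩ := n.exists_idx (hI i hi).1 (hI i hi).2
  refine Smooth.ext fun z => ?_
  rw [centredCoord_apply, centredCoord_apply]
  exact congrArg (fun r => z (n.idx j) - r) (congrFun hxy j)

/-! ### Constraint bivector fields in coordinates -/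

/-- The coefficient `X^{ij}` of a bivector field. -/
def Bivec.coeff {ι : Type} [Fintype ι] (i j : ι) : Bivec ι →ₗ[ℝ] Smooth ι :=
  LinearMap.proj j ∘ₗ LinearMap.proj i ∘ₗ (Bivec ι).subtype

theorem Bivec.coeff_apply {ι : Type} [Fintype ι] (i j : ι) (X : Bivec ι) :
    Bivec.coeff i j X = X.1 i j := rfl

theorem bivec_eq_sum_wedge {ι : Type} [Fintype ι] [DecidableEq ι] (X : Bivec ι) :
    X = (1 / 2 : ℝ) • ∑ i, ∑ j, wedge (Pi.single i (X.1 i j)) (Pi.single j 1) := by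
  refine Subtype.ext (funext fun k => funext fun l => ?_)
  have h : (1 / 2 : ℝ) • (X.1 k l - X.1 l k) = X.1 k l := by
    rw [X.2 l k, sub_neg_eq_add, ← two_smul ℝ, smul_smul]
    norm_num
  rw [← Bivec.coeff_apply k l, ← Bivec.coeff_apply k l, map_smul, map_sum, Bivec.coeff_apply]
  conv_lhs => rw [← h]
  congr 1
  simp only [map_sum, Bivec.coeff_apply, wedge, Finset.sum_sub_distrib, Pi.single_apply]
  simp

theorem wedge_swap {ι : Type} [Fintype ι] (Y Z : ι → Smooth ι) : wedge Y Z = -wedge Z Y :=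
  Subtype.ext (funext fun i => funext fun j => by
    change Y i * Z j - Y j * Z i = -(Z i * Y j - Z j * Y i)
    ring)

theorem single_vecO_of_lt {i : Fin n.T} (hi : (i : ℕ) < n.O) (f : Smooth (Fin n.T)) :
    Pi.single i f ∈ vecO n := fun k hk => by
  rw [Pi.single_eq_of_ne (by rintro rfl; omega)]
  exact zero_mem _

theorem single_vecO (i : Fin n.T) {f : Smooth (Fin n.T)} (hf : f ∈ funO n) :
    Pi.single i f ∈ vecO n := fun k _ => by
  by_cases h : k = i
  · subst h; rwa [Pi.single_eq_same]
  · rw [Pi.single_eq_of_ne h]; exact zero_mem _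

theorem single_vecN {i : Fin n.T} (hi : (i : ℕ) < n.N) {f : Smooth (Fin n.T)} (hf : f ∈ funN n) :
    Pi.single i f ∈ vecN n := by
  refine ⟨fun k hk => ?_, fun k _ _ => ?_⟩
  · rw [Pi.single_eq_of_ne (by rintro rfl; omega)]
    exact zero_mem _
  · by_cases h : k = i
    · subst h; rwa [Pi.single_eq_same]
    · rw [Pi.single_eq_of_ne h]; exact zero_mem _

/-- If either direction lies in the distribution, that factor belongs to `vecO n`, whatever `f` is.
Otherwise `f` vanishes on the submanifold, so the first factor does. -/
theorem wedge_single_bivecO {i j : Fin n.T} {f : Smooth (Fin n.T)}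
    (h : n.O ≤ i → n.O ≤ j → f ∈ funO n) :
    wedge (Pi.single i f) (Pi.single j 1) ∈ bivecO n := by
  by_cases hi : (i : ℕ) < n.O
  · exact Submodule.subset_span ⟨_, single_vecO_of_lt hi f, _, rfl⟩
  by_cases hj : (j : ℕ) < n.O
  · rw [wedge_swap]
    exact neg_mem (Submodule.subset_span ⟨_, single_vecO_of_lt hj 1, _, rfl⟩)
  · exact Submodule.subset_span ⟨_, single_vecO i (h (not_lt.1 hi) (not_lt.1 hj)), _, rfl⟩

theorem mem_bivecO_iff {X : Bivec (Fin n.T)} :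
    X ∈ bivecO n ↔ ∀ i j : Fin n.T, n.O ≤ i → n.O ≤ j → X.1 i j ∈ funO n := by
  constructor
  · intro hX i j hi hj
    have : bivecO n ≤ (funO n).comap (Bivec.coeff i j) := by
      refine Submodule.span_le.2 ?_
      rintro _ ⟨Y, hY, Z, rfl⟩
      exact sub_mem (funO_mul _ (hY i hi)) (funO_mul _ (hY j hj))
    exact this hX
  · intro h
    rw [bivec_eq_sum_wedge X]
    exact Submodule.smul_mem _ _ (sum_mem fun i _ => sum_mem fun j _ =>
      wedge_single_bivecO (h i j))

theorem vecN_funN {Y : Fin n.T → Smooth (Fin n.T)} (hY : Y ∈ vecN n) {i : Fin n.T}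
    (hi : n.O ≤ i) : Y i ∈ funN n := by
  by_cases h : (i : ℕ) < n.N
  · exact hY.2 i hi h
  · exact funO_le_funN (hY.1 i (not_lt.1 h))

theorem mem_bivecN_iff {X : Bivec (Fin n.T)} :
    X ∈ bivecN n ↔ ∀ i j : Fin n.T, n.O ≤ i → n.O ≤ j →
      X.1 i j ∈ funN n ∧ (n.N ≤ i → X.1 i j ∈ funO n) := by
  constructor
  · intro hX i j hi hj
    constructor
    · have : bivecN n ≤ (funN n).comap (Bivec.coeff i j) := by
        refine sup_le (Submodule.span_le.2 ?_) fun X hX =>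
          funO_le_funN (mem_bivecO_iff.1 hX i j hi hj)
        rintro _ ⟨Y, hY, Z, hZ, rfl⟩
        exact sub_mem (mul_funN (vecN_funN hY hi) (vecN_funN hZ hj))
          (mul_funN (vecN_funN hY hj) (vecN_funN hZ hi))
      exact this hX
    · intro hiN
      have : bivecN n ≤ (funO n).comap (Bivec.coeff i j) := by
        refine sup_le (Submodule.span_le.2 ?_) fun X hX => mem_bivecO_iff.1 hX i j hi hj
        rintro _ ⟨Y, hY, Z, hZ, rfl⟩
        exact sub_mem (funO_mul _ (hY.1 i hiN)) (mul_funO _ (hZ.1 i hiN))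
      exact this hX
  · intro h
    rw [bivec_eq_sum_wedge X]
    refine Submodule.smul_mem _ _ (sum_mem fun i _ => sum_mem fun j _ => ?_)
    -- Only pairs of directions that survive in `ℝ^{n_red}` need the summand `Γ_N ∧ Γ_N`. All others
    -- fall into `bivecO n`; for transversal `j` this uses antisymmetry.
    by_cases hred : (n.O ≤ i ∧ (i : ℕ) < n.N) ∧ n.O ≤ j ∧ (j : ℕ) < n.N
    · obtain ⟨⟨hi, hi'⟩, hj, hj'⟩ := hred
      exact Submodule.mem_sup_left (Submodule.subset_span
        ⟨_, single_vecN hi' (h i j hi hj).1, _, single_vecN hj' one_funN, rfl⟩)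
    · refine Submodule.mem_sup_right (wedge_single_bivecO fun hi hj => ?_)
      by_cases hiN : n.N ≤ i
      · exact (h i j hi hj).2 hiN
      · rw [X.2 i j]
        refine neg_mem ((h j i hj hi).2 (not_lt.1 fun hjN => hred ⟨⟨hi, not_le.1 hiN⟩, hj, hjN⟩))

/-! ### Constraint differential operators in terms of their symbols -/

/-- The terms `a_M ∂_M` are treated one by one. If `M` contains a transversal index, the coefficient
vanishes on the submanifold. If `M` is tangential with an index in the distribution, `∂_M` maps
`funN n` into `funO n`. In the remaining case both coefficient and derivative are compatible with
the projection. -/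
theorem mem_C1N_of_symb₁ {D : Hom1 (Fin n.T)} (hD : D ∈ C1diff (Fin n.T))
    (hO : ∀ M : Multiset (Fin n.T), (∃ i ∈ M, n.N ≤ (i : ℕ)) → ∀ x ∈ n.sub, symb₁ D M x = 0)
    (hN : ∀ M : Multiset (Fin n.T), (∀ i ∈ M, n.O ≤ (i : ℕ) ∧ (i : ℕ) < n.N) →
      ∀ x ∈ n.sub, ∀ y ∈ n.sub, n.proj x = n.proj y → symb₁ D M x = symb₁ D M y) :
    D ∈ C1N n := by
  obtain ⟨a, ha, hDa⟩ := exists_symb₁ hD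
  refine ⟨hD, fun f hf => ?_, fun f hf => ?_⟩ <;> rw [hDa] <;>
    refine sum_mem fun M _ => Submodule.smul_mem _ _ ?_ <;>
    by_cases hM : ∃ i ∈ M, n.N ≤ (i : ℕ)
  · refine funO_le_funN (funO_mul _ fun x hx => ?_)
    rw [← ha]
    exact hO M hM x hx
  · push Not at hM
    by_cases hM' : ∃ i ∈ M, (i : ℕ) < n.O
    · obtain ⟨i, hi, hiO⟩ := hM'
      exact funO_le_funN (mul_funO _ (pds_funN_of_mem hM hi hiO hf))
    · push Not at hM'
      refine mul_funN (mem_funN_iff.2 fun x hx y hy hxy => ?_) (pds_funN hM hf)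
      rw [← ha, ← ha]
      exact hN M (fun i hi => ⟨hM' i hi, hM i hi⟩) x hx y hy hxy
  · refine funO_mul _ fun x hx => ?_
    rw [← ha]
    exact hO M hM x hx
  · push Not at hM
    exact mul_funO _ (pds_funO hM hf)

theorem symb₁_opProl (S : MvPolynomial (Fin n.T) (Smooth (Fin n.N))) (M : Multiset (Fin n.T))
    (x : Fin n.T → ℝ) :
    symb₁ (opProl n S) M x =
      multiFactorial M * prol n (MvPolynomial.coeff (Multiset.toFinsupp M) S) x := by
  have h : opProl n S = ∑ᶠ I : Multiset (Fin n.T),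
      prol n (MvPolynomial.coeff (Multiset.toFinsupp I) S) • pds I := by
    refine (finsum_comp_equiv (Multiset.toFinsupp (α := Fin n.T)).toEquiv).symm.trans
      (finsum_congr fun I => ?_)
    change _ • pds (Finsupp.toMultiset (Multiset.toFinsupp I)) = _
    rw [Multiset.toFinsupp_toMultiset]
    rfl
  have h0 : ∀ I ∉ S.support.image Finsupp.toMultiset,
      prol n (MvPolynomial.coeff (Multiset.toFinsupp I) S) = 0 := by
    intro I hI
    have : MvPolynomial.coeff (Multiset.toFinsupp I) S = 0 := by
      by_contra hc
      exact hI (Finset.mem_image.2 ⟨_, MvPolynomial.mem_support_iff.2 hc,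
        Multiset.toFinsupp_toMultiset I⟩)
    rw [this, map_zero]
  rw [h, finsum_eq_sum_of_support_subset _ (s := S.support.image Finsupp.toMultiset), symb₁_sum]
  · exact h0
  · intro I hI
    by_contra hc
    refine hI ?_
    change prol n (MvPolynomial.coeff (Multiset.toFinsupp I) S) • pds I = 0
    rw [h0 I hc, zero_smul]

theorem toFinsupp_mem_extMonomials_iff {M : Multiset (Fin n.T)} :
    Multiset.toFinsupp M ∈ extMonomials n ↔ ∃ (t : Fin n.T) (K : Multiset (Fin n.T)),
      K ≠ 0 ∧ (∀ i ∈ K, (i : ℕ) < n.O) ∧ n.N ≤ t ∧ M = t ::ₘ K := by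
  constructor
  · rintro ⟨k, t, hk, hkO, ht, h⟩
    refine ⟨t, Finsupp.toMultiset k, fun h0 => hk ?_, fun i hi => hkO i ?_, ht, ?_⟩
    · rw [← Finsupp.toMultiset_toFinsupp k, h0, map_zero]
    · exact Finsupp.mem_support_iff.1 (Finsupp.mem_toMultiset k i |>.1 hi)
    · rw [← Multiset.toFinsupp_toMultiset M, h, map_add, Finsupp.toMultiset_single, one_smul,
        add_comm, Multiset.singleton_add]
  · rintro ⟨t, K, hK, hKO, ht, rfl⟩
    refine ⟨Multiset.toFinsupp K, t, fun h0 => hK ?_, fun i hi => hKO i ?_, ht, ?_⟩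
    · rw [← Multiset.toFinsupp_toMultiset K, h0, map_zero]
    · rw [Multiset.toFinsupp_apply] at hi
      exact Multiset.count_ne_zero.1 hi
    · rw [← Multiset.singleton_add, map_add, Multiset.toFinsupp_singleton, add_comm]

/-- The symbol of a differential operator on the monomials of `symExt n`, restricted to `ℝ^{n_N}`,
is the symbol of the prolongation of an element of `symExt n`. -/
theorem exists_symExt {D : Hom1 (Fin n.T)} (hD : D ∈ C1diff (Fin n.T)) :
    ∃ S ∈ symExt n, ∀ M : Multiset (Fin n.T), ∀ x ∈ n.sub,
      (Multiset.toFinsupp M ∈ extMonomials n → symb₁ (opProl n S) M x = symb₁ D M x) ∧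
      (Multiset.toFinsupp M ∉ extMonomials n → symb₁ (opProl n S) M x = 0) := by
  classical
  obtain ⟨a, ha, -⟩ := exists_symb₁ hD
  let F : Finset (Multiset (Fin n.T)) :=
    a.support.filter fun M => Multiset.toFinsupp M ∈ extMonomials n
  -- The factorials undo the scaling of `symb₁`. Restricting the coefficients to `ℝ^{n_N}` loses
  -- nothing, since symbols are only compared there.
  let S : MvPolynomial (Fin n.T) (Smooth (Fin n.N)) :=
    ∑ M ∈ F, MvPolynomial.monomial (Multiset.toFinsupp M)
      ((multiFactorial M)⁻¹ • Smooth.restr (Fin.castLE n.N_le_T) (a M))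
  have hS : ∀ M, MvPolynomial.coeff (Multiset.toFinsupp M) S =
      if Multiset.toFinsupp M ∈ extMonomials n then
        (multiFactorial M)⁻¹ • Smooth.restr (Fin.castLE n.N_le_T) (a M) else 0 := by
    intro M
    simp only [S, MvPolynomial.coeff_sum, MvPolynomial.coeff_monomial,
      EmbeddingLike.apply_eq_iff_eq]
    rw [Finset.sum_ite_eq' F M]
    by_cases hM : Multiset.toFinsupp M ∈ extMonomials n
    · rw [if_pos hM]
      by_cases hM' : a M = 0
      · rw [hM', map_zero, smul_zero, ite_self]
      · rw [if_pos (Finset.mem_filter.2 ⟨Finsupp.mem_support_iff.2 hM', hM⟩)]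
    · rw [if_neg hM, if_neg fun h : M ∈ F => hM (Finset.mem_filter.1 h).2]
  refine ⟨S, fun m hm => ?_, fun M x hx => ⟨fun hM => ?_, fun hM => ?_⟩⟩
  · by_contra hc
    refine hm ?_
    rw [← Finsupp.toMultiset_toFinsupp m, hS, Finsupp.toMultiset_toFinsupp, if_neg hc]
  · rw [symb₁_opProl, hS, if_pos hM, map_smul, Smooth.smul_apply,
      mul_inv_cancel_left₀ (multiFactorial_ne_zero M), ha]
    change a M (Function.extend _ (fun k => x (Fin.castLE n.N_le_T k)) 0) = _
    rw [n.extend_castLE hx]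
  · rw [symb₁_opProl, hS, if_neg hM, map_zero, Smooth.zero_apply, mul_zero]

/-! ### The constraint Hochschild–Kostant–Rosenberg theorem -/

/-- The coefficients of `X` are antisymmetrised values of the cochain on linear centred monomials.
For indices outside the distribution these lie in `funN n`, and in `funO n` for a transversal index,
so the constraint conditions on the cochain become those of `mem_bivecN_iff`. -/
theorem mem_bivecN_of_U_add_δ₁ {X : Bivec (Fin n.T)} {D : Hom1 (Fin n.T)}
    (h : U X + δ₁ D ∈ C2N n) : X ∈ bivecN n := by
  refine mem_bivecN_iff.2 fun i j hi hj => ⟨mem_funN_iff.2 fun x hx y hy hxy => ?_,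
    fun hiN x hx => ?_⟩
  all_goals
    have hp : ∀ (k : Fin n.T) x, n.O ≤ k → centredMonomial x {k} ∈ funN n := fun k x hk =>
      centredMonomial_funN x fun l hl => by rwa [Multiset.mem_singleton.1 hl]
    have hq : ∀ (k : Fin n.T), n.N ≤ k → ∀ x ∈ n.sub, centredMonomial x {k} ∈ funO n :=
      fun k hk x hx => centredMonomial_funO hx (Multiset.mem_singleton_self k) hk
  · have key : ∀ i j : Fin n.T, n.O ≤ i → n.O ≤ j →
        symb₂ (U X + δ₁ D) {i} {j} x = symb₂ (U X + δ₁ D) {i} {j} y := by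
      intro i j hi hj
      by_cases hiN : n.N ≤ i
      · rw [symb₂, h.2.2.1 _ (hq i hiN x hx) _ (hp j x hj) x hx, symb₂,
          h.2.2.1 _ (hq i hiN y hy) _ (hp j y hj) y hy]
      by_cases hjN : n.N ≤ j
      · rw [symb₂, h.2.2.2 _ (hp i x hi) _ (hq j hjN x hx) x hx, symb₂,
          h.2.2.2 _ (hp i y hi) _ (hq j hjN y hy) y hy]
      have hc : ∀ k : Fin n.T, n.O ≤ k → ¬ n.N ≤ k →
          centredMonomial x {k} = centredMonomial y {k} := fun k hk hkN =>
        centredMonomial_congr hxy fun l hl => by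
          rw [Multiset.mem_singleton.1 hl]; exact ⟨hk, not_le.1 hkN⟩
      rw [symb₂, symb₂, hc i hi hiN, hc j hj hjN]
      exact mem_funN_iff.1 (h.2.1 _ (hp i y hi) _ (hp j y hj)) x hx y hy hxy
    rw [bivec_apply_of_U_add_δ₁ (D := D), bivec_apply_of_U_add_δ₁ (D := D), key i j hi hj,
      key j i hj hi]
  · rw [bivec_apply_of_U_add_δ₁ (D := D), symb₂, symb₂,
      h.2.2.1 _ (hq i hiN x hx) _ (hp j x hj) x hx,
      h.2.2.2 _ (hp j x hj) _ (hq i hiN x hx) x hx, sub_zero]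

theorem mem_bivecO_of_U_add_δ₁ {X : Bivec (Fin n.T)} {D : Hom1 (Fin n.T)}
    (h : U X + δ₁ D ∈ C2O n) : X ∈ bivecO n := by
  refine mem_bivecO_iff.2 fun i j hi hj x hx => ?_
  have hp : ∀ k : Fin n.T, n.O ≤ k → centredMonomial x {k} ∈ funN n := fun k hk =>
    centredMonomial_funN x fun l hl => by rwa [Multiset.mem_singleton.1 hl]
  rw [bivec_apply_of_U_add_δ₁ (D := D), symb₂, symb₂, h.2 _ (hp i hi) _ (hp j hj) x hx,
    h.2 _ (hp j hj) _ (hp i hi) x hx, sub_zero]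

/-- A normalized differential operator with constraint coboundary is, up to the prolongation of
an element of `symExt n`, a constraint differential operator. -/
theorem exists_opProl_add {D : Hom1 (Fin n.T)} (hD : D ∈ C1diff (Fin n.T))
    (h1 : ∀ i x, symb₁ D {i} x = 0) (h : δ₁ D ∈ C2N n) :
    ∃ S ∈ symExt n, ∃ E ∈ C1N n, D = opProl n S + E := by
  obtain ⟨S, hS, hSD⟩ := exists_symExt hD
  have hsplit : ∀ {I J : Multiset (Fin n.T)}, I ≠ 0 → J ≠ 0 → ∀ x,
      symb₁ D (I + J) x = -symb₂ (δ₁ D) I J x := fun hI hJ x => by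
    rw [symb₂_δ₁_of_ne hI hJ, neg_neg]
  refine ⟨S, hS, D - opProl n S, mem_C1N_of_symb₁ (sub_mem hD (opProl_mem S)) ?_ ?_, by abel⟩
  · rintro M ⟨t, ht, htN⟩ x hx
    by_cases hM : Multiset.toFinsupp M ∈ extMonomials n
    · rw [symb₁_sub, (hSD M x hx).1 hM, sub_self]
    rw [symb₁_sub, (hSD M x hx).2 hM, sub_zero]
    obtain ⟨K, rfl⟩ := Multiset.exists_cons_of_mem ht
    by_cases hK : K = 0
    · subst hK; exact h1 t x
    by_cases hKO : ∀ i ∈ K, (i : ℕ) < n.O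
    · exact absurd (toFinsupp_mem_extMonomials_iff.2 ⟨t, K, hK, hKO, htN, rfl⟩) hM
    push Not at hKO
    obtain ⟨k, hk, hkO⟩ := hKO
    obtain ⟨L, rfl⟩ := Multiset.exists_cons_of_mem hk
    -- Since `k` is not in the distribution, `M` is split as `{k} + (t ::ₘ L)`: the first monomial
    -- lies in `funN n`, the second in `funO n`, so `δ₁ D` takes them into `funO n`.
    rw [Multiset.cons_swap, ← Multiset.singleton_add,
      hsplit (Multiset.singleton_ne_zero k) Multiset.cons_ne_zero, symb₂,
      h.2.2.2 _ (centredMonomial_funN x fun l hl => by rwa [Multiset.mem_singleton.1 hl]) _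
        (centredMonomial_funO hx (Multiset.mem_cons_self t L) htN) x hx, neg_zero]
  · intro M hM x hx y hy hxy
    have hMe : Multiset.toFinsupp M ∉ extMonomials n := by
      rw [toFinsupp_mem_extMonomials_iff]
      rintro ⟨t, K, -, -, ht, rfl⟩
      exact absurd (hM t (Multiset.mem_cons_self t K)).2 (not_lt.2 ht)
    rw [symb₁_sub, symb₁_sub, (hSD M x hx).2 hMe, (hSD M y hy).2 hMe, sub_zero, sub_zero]
    have key : ∀ I J : Multiset (Fin n.T), (∀ i ∈ I, n.O ≤ (i : ℕ) ∧ (i : ℕ) < n.N) →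
        (∀ i ∈ J, n.O ≤ (i : ℕ) ∧ (i : ℕ) < n.N) →
        symb₂ (δ₁ D) I J x = symb₂ (δ₁ D) I J y := by
      intro I J hI hJ
      rw [symb₂, symb₂, centredMonomial_congr hxy hI, centredMonomial_congr hxy hJ]
      exact mem_funN_iff.1 (h.2.1 _ (centredMonomial_funN y fun i hi => (hI i hi).1) _
        (centredMonomial_funN y fun i hi => (hJ i hi).1)) x hx y hy hxy
    induction M using Multiset.induction_on with
    | empty =>
      -- The empty multi-index has no nonempty splitting, but at `(0, 0)` the three terms of `δ₁ D`
      -- leave exactly one copy of the symbol.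
      have h0 : ∀ x, symb₁ D 0 x = symb₂ (δ₁ D) 0 0 x := fun x => by
        rw [symb₂_δ₁, if_pos rfl, add_zero]; ring
      rw [h0, h0]
      exact key 0 0 (by simp) (by simp)
    | cons i K _ =>
      by_cases hK : K = 0
      · subst hK
        exact (h1 i x).trans (h1 i y).symm
      · rw [← Multiset.singleton_add, hsplit (Multiset.singleton_ne_zero i) hK,
          hsplit (Multiset.singleton_ne_zero i) hK, key]
        · intro j hj
          rw [Multiset.mem_singleton.1 hj]
          exact hM i (Multiset.mem_cons_self i K)
        · exact fun j hj => hM j (Multiset.mem_cons_of_mem hj)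

/-- Splitting off the transversal index `t` shows that `opProl n S` and `E` have the same symbol at
`t ::ₘ K`. There the symbol of `E` vanishes on the submanifold, because the monomial lies in `funO
n` and `E` preserves it. Prolonged coefficients are determined by their values there. -/
theorem symExt_eq_zero {S : MvPolynomial (Fin n.T) (Smooth (Fin n.N))} (hS : S ∈ symExt n)
    {E : Hom1 (Fin n.T)} (hE : E ∈ C1N n) (h : δ₁ (opProl n S) = δ₁ E) : S = 0 := by
  refine MvPolynomial.ext _ _ fun m => ?_
  rw [MvPolynomial.coeff_zero]
  by_contra hm
  have hmem := hS m hm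
  obtain ⟨M, rfl⟩ := Multiset.toFinsupp.surjective m
  obtain ⟨t, K, hK, hKO, ht, rfl⟩ := toFinsupp_mem_extMonomials_iff.1 hmem
  refine hm (Smooth.ext fun y => ?_)
  set x := Function.extend (Fin.castLE n.N_le_T) y 0 with hx
  have hxs : x ∈ n.sub := n.extend_castLE_mem_sub y
  have h1 : symb₁ (opProl n S) (t ::ₘ K) x = symb₁ E (t ::ₘ K) x := by
    have ht0 := Multiset.singleton_ne_zero t
    have := symb₂_δ₁_of_ne (D := opProl n S) ht0 hK x
    rw [h, symb₂_δ₁_of_ne ht0 hK] at this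
    exact (neg_injective this).symm
  have h2 : symb₁ E (t ::ₘ K) x = 0 :=
    hE.2.2 _ (centredMonomial_funO hxs (Multiset.mem_cons_self t K) ht) x hxs
  rw [h2, symb₁_opProl] at h1
  have h3 := (mul_eq_zero.1 h1).resolve_left (multiFactorial_ne_zero _)
  have h4 : (fun k => x (Fin.castLE n.N_le_T k)) = y :=
    funext fun k => (Fin.castLE_injective n.N_le_T).extend_apply y 0 k
  rw [prol, Smooth.pull_apply, h4] at h3
  exact h3

variable (n)

theorem UextHH_N_bijective : Function.Bijective (UextHH n).N := by
  constructor
  · refine (injective_iff_map_eq_zero _).2 ?_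
    rintro ⟨X, S⟩ h
    obtain ⟨E, hE, hES⟩ := (Submodule.Quotient.mk_eq_zero _).1 h
    replace hES : δ₁ E = U X.1 + δ₁ (opProl n S.1) := hES
    have hX : X.1 = 0 := by
      refine bivec_eq_zero_of_U_eq_δ₁ (D := opProl n S.1 - E) ?_
      rw [map_sub, ← add_sub_assoc, hES, sub_self]
    rw [hX, map_zero, zero_add] at hES
    exact Prod.ext (Subtype.ext hX) (Subtype.ext (symExt_eq_zero S.2 hE hES.symm))
  · rintro ⟨B⟩
    obtain ⟨X, D, hD, hB, h1⟩ := exists_U_add_δ₁ (Z2N_le B.2)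
    have hBN : U X + δ₁ D ∈ C2N n := hB ▸ B.2.1
    have hX := mem_bivecN_of_U_add_δ₁ hBN
    have hδ : δ₁ D ∈ C2N n := by
      have := sub_mem hBN (U_bivecN hX)
      rwa [add_sub_cancel_left] at this
    obtain ⟨S, hS, E, hE, rfl⟩ := exists_opProl_add hD h1 hδ
    refine ⟨(⟨X, hX⟩, ⟨S, hS⟩), (Submodule.Quotient.eq _).2 ⟨-E, neg_mem hE, ?_⟩⟩
    change δ₁ (-E) = (U X + δ₁ (opProl n S)) - B.1
    rw [hB, map_neg, map_add]
    abel

/-- Absorbing the coboundary between the two representatives into `D` writes a cochain in `C2O n` as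
`U X + δ₁ D`, and its symbol then forces `X` into `bivecO n`. The `symExt` component is
unrestricted. -/
theorem mem_O_of_UextHH_N_mem_O {p : (conXext n).N} (hp : (UextHH n).N p ∈ (conHH2 n).O) :
    p ∈ (conXext n).O := by
  obtain ⟨B, hB, hBp⟩ := hp
  obtain ⟨X, S⟩ := p
  obtain ⟨E, -, hE⟩ := (Submodule.Quotient.eq _).1 hBp
  replace hE : δ₁ E = B.1 - (U X.1 + δ₁ (opProl n S.1)) := hE
  replace hB : B.1 ∈ C2O n := hB
  refine ⟨mem_bivecO_of_U_add_δ₁ (D := opProl n S.1 + E) ?_, trivial⟩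
  have : U X.1 + δ₁ (opProl n S.1 + E) = B.1 := by
    rw [map_add, hE]
    abel
  exact this.symm ▸ hB

end Constraint

/-- A morphism of constraint modules with bijective components which reflects the `0`-component is
an isomorphism. -/
theorem ConHom.isIso_of_bijective {E F : ConModule} (f : ConHom E F)
    (hT : Function.Bijective f.T) (hN : Function.Bijective f.N)
    (hO : ∀ x, f.N x ∈ F.O → x ∈ E.O) : f.IsIso := by
  let eT := LinearEquiv.ofBijective f.T hT
  let eN := LinearEquiv.ofBijective f.N hN
  have hNs : ∀ y, f.N (eN.symm y) = y := eN.apply_symm_apply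
  refine ⟨{ T := eT.symm, N := eN.symm, map_O := fun y hy => hO _ ?_, comm := fun y => ?_ },
    eT.symm_apply_apply, eT.apply_symm_apply, eN.symm_apply_apply, eN.apply_symm_apply⟩
  · change f.N (eN.symm y) ∈ F.O
    rwa [hNs]
  · apply hT.1
    change f.T (E.ι (eN.symm y)) = f.T (eT.symm (F.ι y))
    rw [← f.comm, hNs]
    exact (eT.apply_symm_apply _).symm

theorem UextHH_isIso (n : ConDim) : (UextHH n).IsIso :=
  (UextHH n).isIso_of_bijective (UHH_bijective (Fin n.T)) (UextHH_N_bijective n)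
    fun _ => mem_O_of_UextHH_N_mem_O n

section Reduction

variable {n : ConDim}

/-! ### Reduction of functions and cochains -/

theorem funReduces_pull (a : Smooth (Fin n.red)) : FunReduces n (Smooth.pull n.idx a) a :=
  fun _ _ => rfl

theorem FunReduces.mem_funN {f : Smooth (Fin n.T)} {a : Smooth (Fin n.red)}
    (h : FunReduces n f a) : f ∈ funN n :=
  mem_funN_iff.2 fun x hx y hy hxy => by rw [h x hx, h y hy, hxy]

theorem funReduces_restr {f : Smooth (Fin n.T)} (hf : f ∈ funN n) :
    FunReduces n f (Smooth.restr n.idx f) := fun x hx => by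
  rw [Smooth.restr_apply]
  exact mem_funN_iff.1 hf x hx _ (n.extend_mem_sub _) (n.proj_extend _).symm

theorem FunReduces.sub_pull_mem {f : Smooth (Fin n.T)} {a : Smooth (Fin n.red)}
    (h : FunReduces n f a) : f - Smooth.pull n.idx a ∈ funO n := fun x hx => by
  rw [Smooth.sub_apply, h x hx]
  exact sub_self _

theorem restr_eq_zero {f : Smooth (Fin n.T)} (hf : f ∈ funO n) : Smooth.restr n.idx f = 0 :=
  Smooth.ext fun y => hf _ (n.extend_mem_sub y)

/-- Replacing `f` and `g` by the constant extensions of their reductions changes them by elements of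
`funO n`, hence changes `B f g` by an element of `funO n`. -/
theorem cochainReduces_reduce {B : Hom2 (Fin n.T)} (hB : B ∈ C2N n) :
    CochainReduces n B (Hom2.reduce n.idx B) := by
  intro f g a a' hf hg x hx
  have h1 : B f g - B (Smooth.pull n.idx a) (Smooth.pull n.idx a') ∈ funO n := by
    have : B f g - B (Smooth.pull n.idx a) (Smooth.pull n.idx a') =
        B (f - Smooth.pull n.idx a) g +
          B (Smooth.pull n.idx a) (g - Smooth.pull n.idx a') := by
      rw [map_sub, map_sub, LinearMap.sub_apply]
      abel
    rw [this]
    exact add_mem (hB.2.2.1 _ hf.sub_pull_mem _ hg.mem_funN)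
      (hB.2.2.2 _ (funReduces_pull a).mem_funN _ hg.sub_pull_mem)
  have h2 := funReduces_restr (hB.2.1 _ (funReduces_pull a).mem_funN _
    (funReduces_pull a').mem_funN) x hx
  rw [sub_eq_zero.1 (h1 x hx)]
  exact h2

theorem reduce_eq_zero_iff {B : Hom2 (Fin n.T)} (hB : B ∈ C2N n) :
    Hom2.reduce n.idx B = 0 ↔ B ∈ C2O n := by
  constructor
  · refine fun h => ⟨hB, fun f hf g hg x hx => ?_⟩
    rw [cochainReduces_reduce hB f g _ _ (funReduces_restr hf) (funReduces_restr hg) x hx, h]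
    rfl
  · exact fun h => LinearMap.ext₂ fun a b =>
      restr_eq_zero (h.2 _ (funReduces_pull a).mem_funN _ (funReduces_pull b).mem_funN)

theorem Hom2.reduce_mem_of_C2N {B : Hom2 (Fin n.T)} (hB : B ∈ C2N n) :
    Hom2.reduce n.idx B ∈ C2diff (Fin n.red) := Hom2.reduce_mem n.idx_injective hB.1

theorem idx_lt_of_mem_map {I : Multiset (Fin n.red)} : ∀ i ∈ I.map n.idx, (i : ℕ) < n.N := by
  intro i hi
  obtain ⟨j, -, rfl⟩ := Multiset.mem_map.1 hi
  exact n.idx_lt j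

theorem pull_mul_funN (c : Smooth (Fin n.red)) {f : Smooth (Fin n.T)} (hf : f ∈ funN n) :
    Smooth.pull n.idx c * f ∈ funN n := mul_funN (funReduces_pull c).mem_funN hf

/-- The lift differentiates only in the directions `n.idx j` and has pulled-back coefficients, so it
preserves both function spaces. It is used to lift coboundaries. -/
theorem exists_C1N_reduce {d : Hom1 (Fin n.red)} (hd : d ∈ C1diff (Fin n.red)) :
    ∃ D ∈ C1N n, Hom1.reduce n.idx D = d := by
  induction hd using Submodule.span_induction with
  | mem d hd =>
    obtain ⟨I, rfl⟩ := hd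
    refine ⟨pds (I.map n.idx), ⟨Submodule.subset_span ⟨_, rfl⟩,
      fun f hf => pds_funN idx_lt_of_mem_map hf, fun f hf => pds_funO idx_lt_of_mem_map hf⟩,
      LinearMap.ext fun a => ?_⟩
    rw [Hom1.reduce_apply, pds_map_pull n.idx_injective, Smooth.restr_pull n.idx_injective]
  | zero => exact ⟨0, zero_mem _, rfl⟩
  | add d d' _ _ h h' =>
    obtain ⟨D, hD, rfl⟩ := h
    obtain ⟨D', hD', rfl⟩ := h'
    exact ⟨D + D', add_mem hD hD', rfl⟩
  | smul c d _ h =>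
    obtain ⟨D, hD, rfl⟩ := h
    refine ⟨Smooth.pull n.idx c • D, ⟨Submodule.smul_mem _ _ hD.1,
      fun f hf => pull_mul_funN c (hD.2.1 f hf), fun f hf => mul_funO _ (hD.2.2 f hf)⟩,
      LinearMap.ext fun a => ?_⟩
    rw [Hom1.reduce_apply, LinearMap.smul_apply, smul_eq_mul, Smooth.restr_mul,
      Smooth.restr_pull n.idx_injective]
    rfl

theorem exists_C2N_reduce {b : Hom2 (Fin n.red)} (hb : b ∈ C2diff (Fin n.red)) :
    ∃ B ∈ C2N n, Hom2.reduce n.idx B = b := by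
  induction hb using Submodule.span_induction with
  | mem b hb =>
    obtain ⟨⟨I, J⟩, rfl⟩ := hb
    refine ⟨cup (pds (I.map n.idx)) (pds (J.map n.idx)),
      ⟨Submodule.subset_span ⟨(_, _), rfl⟩,
      fun f hf g hg => mul_funN (pds_funN idx_lt_of_mem_map hf) (pds_funN idx_lt_of_mem_map hg),
      fun f hf g hg => funO_mul _ (pds_funO idx_lt_of_mem_map hf),
      fun f hf g hg => mul_funO _ (pds_funO idx_lt_of_mem_map hg)⟩,
      LinearMap.ext₂ fun a a' => ?_⟩
    rw [Hom2.reduce_apply, cup_apply, pds_map_pull n.idx_injective,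
      pds_map_pull n.idx_injective, Smooth.restr_mul, Smooth.restr_pull n.idx_injective,
      Smooth.restr_pull n.idx_injective, cup_apply]
  | zero => exact ⟨0, zero_mem _, rfl⟩
  | add d d' _ _ h h' =>
    obtain ⟨D, hD, rfl⟩ := h
    obtain ⟨D', hD', rfl⟩ := h'
    exact ⟨D + D', add_mem hD hD', rfl⟩
  | smul c d _ h =>
    obtain ⟨D, hD, rfl⟩ := h
    refine ⟨Smooth.pull n.idx c • D, ⟨Submodule.smul_mem _ _ hD.1,
      fun f hf g hg => pull_mul_funN c (hD.2.1 f hf g hg),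
      fun f hf g hg => mul_funO _ (hD.2.2.1 f hf g hg),
      fun f hf g hg => mul_funO _ (hD.2.2.2 f hf g hg)⟩,
      LinearMap.ext₂ fun a a' => ?_⟩
    rw [Hom2.reduce_apply, LinearMap.smul_apply, LinearMap.smul_apply, smul_eq_mul,
      Smooth.restr_mul, Smooth.restr_pull n.idx_injective]
    rfl

/-! ### Reduction of bivector fields -/

theorem bivecReduces_reduce {X : Bivec (Fin n.T)} (hX : X ∈ bivecN n) :
    BivecReduces n X (Bivec.reduce n.idx X) := fun i j =>
  funReduces_restr (mem_bivecN_iff.1 hX _ _ (n.le_idx i) (n.le_idx j)).1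

theorem bivec_reduce_eq_zero_iff {X : Bivec (Fin n.T)} (hX : X ∈ bivecN n) :
    Bivec.reduce n.idx X = 0 ↔ X ∈ bivecO n := by
  constructor
  · refine fun h => mem_bivecO_iff.2 fun i j hi hj => ?_
    by_cases hiN : n.N ≤ i
    · exact (mem_bivecN_iff.1 hX i j hi hj).2 hiN
    by_cases hjN : n.N ≤ j
    · rw [X.2 i j]
      exact neg_mem ((mem_bivecN_iff.1 hX j i hj hi).2 hjN)
    obtain ⟨k, rfl⟩ := n.exists_idx hi (not_le.1 hiN)
    obtain ⟨l, rfl⟩ := n.exists_idx hj (not_le.1 hjN)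
    intro x hx
    rw [bivecReduces_reduce hX k l x hx, h]
    rfl
  · intro h
    refine Subtype.ext (funext fun k => funext fun l => ?_)
    exact restr_eq_zero (mem_bivecO_iff.1 h _ _ (n.le_idx k) (n.le_idx l))

theorem exists_bivecN_reduce (Y : Bivec (Fin n.red)) :
    ∃ X ∈ bivecN n, Bivec.reduce n.idx X = Y := by
  let X : Bivec (Fin n.T) := (1 / 2 : ℝ) • ∑ k, ∑ l,
    wedge (Pi.single (n.idx k) (Smooth.pull n.idx (Y.1 k l))) (Pi.single (n.idx l) 1)
  have hX : X ∈ bivecN n := Submodule.smul_mem _ _ (sum_mem fun k _ => sum_mem fun l _ =>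
    Submodule.mem_sup_left (Submodule.subset_span
      ⟨_, single_vecN (n.idx_lt k) (funReduces_pull _).mem_funN,
        _, single_vecN (n.idx_lt l) one_funN, rfl⟩))
  refine ⟨X, hX, ?_⟩
  rw [map_smul]
  conv_rhs => rw [bivec_eq_sum_wedge Y]
  simp only [map_sum]
  congr 1
  refine Finset.sum_congr rfl fun k _ => Finset.sum_congr rfl fun l _ => ?_
  have hs : ∀ (k p : Fin n.red) (a : Smooth (Fin n.red)),
      Smooth.restr n.idx ((Pi.single (n.idx k) (Smooth.pull n.idx a) :
        Fin n.T → Smooth (Fin n.T)) (n.idx p)) = (Pi.single k a : Fin n.red → _) p := by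
    intro k p a
    by_cases h : p = k
    · subst h
      rw [Pi.single_eq_same, Pi.single_eq_same, Smooth.restr_pull n.idx_injective]
    · rw [Pi.single_eq_of_ne h, Pi.single_eq_of_ne (fun h' => h (n.idx_injective h')), map_zero]
  refine Subtype.ext (funext fun p => funext fun q => ?_)
  rw [Bivec.reduce_apply]
  change Smooth.restr n.idx (_ * _ - _ * _) = _ * _ - _ * _
  have h1 : (1 : Smooth (Fin n.T)) = Smooth.pull n.idx 1 := rfl
  rw [map_sub, Smooth.restr_mul, Smooth.restr_mul, h1, hs, hs, hs, hs]

/-! ### The canonical isomorphisms -/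

/-- The isomorphism `M / ker f ≃ N` induced by a surjective linear map `f : M → N`. -/
theorem exists_quotient_equiv {M N : Type*} [AddCommGroup M] [Module ℝ M] [AddCommGroup N]
    [Module ℝ N] (f : M →ₗ[ℝ] N) (p : Submodule ℝ M) (hp : ∀ x, f x = 0 ↔ x ∈ p)
    (hf : Function.Surjective f) :
    ∃ e : (M ⧸ p) ≃ₗ[ℝ] N, ∀ x, e (Submodule.Quotient.mk x) = f x := by
  obtain rfl : LinearMap.ker f = p := Submodule.ext hp
  exact ⟨f.quotKerEquivOfSurjective hf, fun _ => rfl⟩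

variable (n)

theorem exists_bivec_equiv : ∃ Φ : (conXext n).Red ≃ₗ[ℝ] Bivec (Fin n.red),
    ∀ (X : bivecN n) (D : symExt n),
      Φ (Submodule.Quotient.mk (X, D)) = Bivec.reduce n.idx X.1 := by
  obtain ⟨Φ, hΦ⟩ := exists_quotient_equiv
    (Bivec.reduce n.idx ∘ₗ (conXext n).ι) (conXext n).O
    (fun p => (bivec_reduce_eq_zero_iff p.1.2).trans ⟨fun h => ⟨h, trivial⟩, fun h => h.1⟩)
    (fun Y => by
      obtain ⟨X, hX, hXY⟩ := exists_bivecN_reduce Y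
      exact ⟨(⟨X, hX⟩, 0), hXY⟩)
  exact ⟨Φ, fun X D => hΦ (X, D)⟩

theorem exists_cochain_equiv :
    ∃ Ψ : (conC2 n).Red ≃ₗ[ℝ] (C2diff (Fin n.red)).restrictScalars ℝ,
      ∀ B : C2N n, (Ψ (Submodule.Quotient.mk B)).1 = Hom2.reduce n.idx B.1 := by
  obtain ⟨Ψ, hΨ⟩ := exists_quotient_equiv
    ((Hom2.reduce n.idx ∘ₗ (C2N n).subtype).codRestrict
      ((C2diff (Fin n.red)).restrictScalars ℝ) fun B => Hom2.reduce_mem_of_C2N B.2)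
    (conC2 n).O
    (fun B => Subtype.ext_iff.trans (reduce_eq_zero_iff B.2))
    (fun b => by
      obtain ⟨B, hB, hBb⟩ := exists_C2N_reduce b.2
      exact ⟨⟨B, hB⟩, Subtype.ext hBb⟩)
  exact ⟨Ψ, fun B => congrArg Subtype.val (hΨ B)⟩

/-- The reduction of constraint cocycles. -/
def reduceCocycle : Z2N n →ₗ[ℝ] Z2 (Fin n.red) :=
  (Hom2.reduce n.idx ∘ₗ (Z2N n).subtype).codRestrict (Z2 (Fin n.red))
    fun B => Hom2.reduce_mem_Z2 n.idx_injective (Z2N_le B.2)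

variable {n} in
-- If the reduced cocycle is the coboundary of `d`, lift `d` to a constraint operator `D`; then `B -
-- δ₁ D` reduces to zero and so lies in `C2O n`. Conversely, a representative in `C2O n` reduces to
-- zero, and a constraint coboundary reduces to a coboundary.
theorem mk_reduceCocycle_eq_zero_iff (B : Z2N n) :
    (Submodule.Quotient.mk (reduceCocycle n B) : HH2diff (Fin n.red)) = 0 ↔
      (Submodule.Quotient.mk B : (conHH2 n).N) ∈ (conHH2 n).O := by
  rw [Submodule.Quotient.mk_eq_zero]
  constructor
  · rintro ⟨d, hd, hdB⟩
    obtain ⟨D, hD, rfl⟩ := exists_C1N_reduce hd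
    replace hdB : δ₁ (Hom1.reduce n.idx D) = Hom2.reduce n.idx B.1 := hdB
    have hδ : δ₁ D ∈ B2N n := ⟨D, hD, rfl⟩
    have hmem : B.1 - δ₁ D ∈ Z2N n := sub_mem B.2 (B2N_le_Z2N hδ)
    refine ⟨⟨B.1 - δ₁ D, hmem⟩, (reduce_eq_zero_iff hmem.1).1 ?_,
      (Submodule.Quotient.eq _).2 ?_⟩
    · rw [map_sub, Hom2.reduce_δ₁ n.idx_injective, hdB, sub_self]
    · change B.1 - δ₁ D - B.1 ∈ B2N n
      rw [sub_sub_cancel_left]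
      exact neg_mem hδ
  · rintro ⟨C, hC, hCB⟩
    obtain ⟨D, hD, hDC⟩ := (Submodule.Quotient.eq _).1 hCB
    replace hDC : δ₁ D = C.1 - B.1 := hDC
    refine ⟨-Hom1.reduce n.idx D, neg_mem (Hom1.reduce_mem n.idx_injective hD.1), ?_⟩
    change δ₁ (-Hom1.reduce n.idx D) = Hom2.reduce n.idx B.1
    rw [map_neg, ← Hom2.reduce_δ₁ n.idx_injective, hDC, map_sub,
      (reduce_eq_zero_iff C.2.1).2 hC, zero_sub, neg_neg]

theorem exists_cohomology_equiv : ∃ Θ : (conHH2 n).Red ≃ₗ[ℝ] HH2diff (Fin n.red),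
    ∀ B : Z2N n, Θ (Submodule.Quotient.mk (Submodule.Quotient.mk B)) =
      Submodule.Quotient.mk (reduceCocycle n B) := by
  have hker : (B2N n).submoduleOf (Z2N n) ≤ LinearMap.ker
      (((B2 (Fin n.red)).submoduleOf (Z2 (Fin n.red))).mkQ ∘ₗ reduceCocycle n) := by
    intro B hB
    refine (mk_reduceCocycle_eq_zero_iff B).2 ?_
    have : (Submodule.Quotient.mk B : (conHH2 n).N) = 0 :=
      (Submodule.Quotient.mk_eq_zero _).2 hB
    rw [this]
    exact zero_mem _
  obtain ⟨Θ, hΘ⟩ := exists_quotient_equiv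
    (((B2N n).submoduleOf (Z2N n)).liftQ _ hker) (conHH2 n).O
    (fun q => by
      obtain ⟨B, rfl⟩ := Submodule.Quotient.mk_surjective _ q
      exact mk_reduceCocycle_eq_zero_iff B)
    (fun q => by
      -- By classical HKR the class is represented by `U Y`. A lift `X` of the bivector field then
      -- gives `U X`, which is automatically a constraint cocycle.
      obtain ⟨Y, rfl⟩ := (UHH_bijective (Fin n.red)).2 q
      obtain ⟨X, hX, rfl⟩ := exists_bivecN_reduce Y
      refine ⟨Submodule.Quotient.mk ⟨U X, U_bivecN hX, (U_mem_Z2 X).2⟩,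
        congrArg Submodule.Quotient.mk (Subtype.ext ?_)⟩
      exact Hom2.reduce_U n.idx_injective X)
  exact ⟨Θ, fun B => hΘ (Submodule.Quotient.mk B)⟩

variable {n} in
-- The correction `δ₁ (opProl n D)` lies in `C2O n` and therefore disappears under reduction.
theorem reduce_UextN (p : bivecN n × symExt n) :
    Hom2.reduce n.idx (UextN n p) = U (Bivec.reduce n.idx p.1.1) := by
  obtain ⟨X, D⟩ := p
  rw [UextN_apply, map_add, Hom2.reduce_U n.idx_injective,
    (reduce_eq_zero_iff (C2O_le_C2N (δ₁_opProl_mem D.2))).2 (δ₁_opProl_mem D.2), add_zero]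

end Reduction

end ConstraintHKR

end

theorem mainTheorem12 (n : ConDim) :
    ∃ (Φ : (conXext n).Red ≃ₗ[ℝ] Bivec (Fin n.red))
      (Ψ : (conC2 n).Red ≃ₗ[ℝ] (C2diff (Fin n.red)).restrictScalars ℝ)
      (Θ : (conHH2 n).Red ≃ₗ[ℝ] HH2diff (Fin n.red)),
      -- `Φ`, `Ψ` and `Θ` are the canonical identifications
      (∀ (X : bivecN n) (D : symExt n),
        BivecReduces n X.1 (Φ (Submodule.Quotient.mk (X, D)))) ∧
      (∀ B : C2N n, CochainReduces n B.1 (Ψ (Submodule.Quotient.mk B)).1) ∧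
      (∀ B : Z2N n, ∃ b : Z2 (Fin n.red), CochainReduces n B.1 b.1 ∧
        Θ (Submodule.Quotient.mk (Submodule.Quotient.mk B)) = Submodule.Quotient.mk b) ∧
      -- on cochains
      (∀ X, Ψ ((UextC n).red X) = UC (Fin n.red) (Φ X)) ∧
      -- in cohomology
      (UextHH n).IsIso ∧
      (∀ X, Θ ((UextHH n).red X) = UHH (Fin n.red) (Φ X)) ∧
      Function.Bijective (UextHH n).red ∧
      Function.Bijective (UHH (Fin n.red)) := by
  obtain ⟨Φ, hΦ⟩ := exists_bivec_equiv n
  obtain ⟨Ψ, hΨ⟩ := exists_cochain_equiv n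
  obtain ⟨Θ, hΘ⟩ := exists_cohomology_equiv n
  have hΘU : ∀ X, Θ ((UextHH n).red X) = UHH (Fin n.red) (Φ X) := by
    intro X
    obtain ⟨p, rfl⟩ := Submodule.Quotient.mk_surjective _ X
    refine (hΘ ⟨UextN n p, UextN_mem p⟩).trans (Eq.trans ?_
      (congrArg (UHH (Fin n.red)) (hΦ p.1 p.2).symm))
    exact congrArg Submodule.Quotient.mk (Subtype.ext (reduce_UextN p))
  refine ⟨Φ, Ψ, Θ, fun X D => ?_, fun B => ?_, fun B => ?_, fun X => ?_, UextHH_isIso n, hΘU,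
    ?_, UHH_bijective _⟩
  · rw [hΦ]
    exact bivecReduces_reduce X.2
  · rw [hΨ]
    exact cochainReduces_reduce B.2
  · exact ⟨reduceCocycle n B, cochainReduces_reduce B.2.1, hΘ B⟩
  · obtain ⟨p, rfl⟩ := Submodule.Quotient.mk_surjective _ X
    exact Subtype.ext ((hΨ ⟨UextN n p, (UextN_mem p).1⟩).trans
      ((reduce_UextN p).trans (congrArg U (hΦ p.1 p.2).symm)))
  -- In the commuting square the classical HKR map and the two canonical identifications are
  -- bijective, so the reduced map is too.
  · have : Function.Bijective (Θ ∘ (UextHH n).red) := by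
      rw [show Θ ∘ (UextHH n).red = UHH (Fin n.red) ∘ Φ from funext hΘU]
      exact (UHH_bijective _).comp Φ.bijective
    exact (Function.Bijective.of_comp_iff' Θ.bijective _).1 this
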